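/- Let $M$ be a smooth four-dimensional manifold with a smooth Riemannian metric $g$, and let $f\in C^\infty(M)$ satisfy $\mathrm{Ric}+\nabla^2 f=\lambda g$ for some constant $\lambda\in\mathbb R$ (a gradient Ricci soliton). Curvature is normalized by $K(e_i,e_j)=R_{ijij}$ for orthonormal $e_i,e_j$, $R_{ik}=g^{jl}R_{ijkl}$, $R=g^{ij}R_{ij}$; $W$ is the Weyl tensor and $\mathring{\mathrm{Ric}}=\mathrm{Ric}-\frac R4 g$. Put $$D_{jkl}=2\nabla^iW_{ijkl}-W_{ijkl}\nabla^if .$$ Then, in arbitrary local coordinates, $$D_{jkl}=\tfrac12\,(R_{jl}\nabla_kf-R_{jk}\nabla_lf)+\tfrac1{12}\,(\nabla_kR\,g_{jl}-\nabla_lR\,g_{jk})-\tfrac R6\,(g_{jl}\nabla_kf-g_{jk}\nabla_lf).$$ Fix an orientation of $M$, or only of a coordinate domain of $M$. For indices $k\ne l$ with respect to a positively oriented orthonormal basis $e_1,\dots,e_4$ of a tangent space, let $(k',l')$ be the pair for which $(k,l,k',l')$ is an even permutation of $(1,2,3,4)$; for a tensor that is skew in $k,l$, the component with $k',l'$ in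 place of $k,l$ is set to be $0$ if $k=l$. (So priming a pair is the Hodge star on that pair.) Let $$W^\pm_{ijkl}=\tfrac14\,(W_{ijkl}\pm W_{ijk'l'}\pm W_{i'j'kl}+W_{i'j'k'l'}),\qquad D^\pm_{jkl}=2\nabla^iW^\pm_{ijkl}-W^\pm_{ijkl}\nabla^if .$$ Then, in every positively oriented orthonormal basis, $D^\pm_{jkk}=0$, and for all $j$ and all $k\neq l$ $$\begin{aligned}D^\pm_{jkl}={}&\tfrac14\,(R_{jl}\nabla_kf-R_{jk}\nabla_lf)+\tfrac1{24}\,(\nabla_kR\,g_{jl}-\nabla_lR\,g_{jk})-\tfrac R{12}\,(g_{jl}\nabla_kf-g_{jk}\nabla_lf)\\&\pm\tfrac14\,(R_{jl'}\nabla_{k'}f-R_{jk'}\nabla_{l'}f)\pm\tfrac1{24}\,(\nabla_{k'}R\,g_{jl'}-\nabla_{l'}R\,g_{jk'})\mp\tfrac R{12}\,(g_{jl'}\nabla_{k'}f-g_{jk'}\nabla_{l'}f).\end{aligned}$$ Moreover, with the norms $|B|^2=B_{jkl}B^{jkl}$, $|A|^2=A_{ij}A^{ij}$ and $|\theta|^2=\theta_i\theta^i$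 of $(0,3)$-tensors, $(0,2)$-tensors and 1-forms (or vectors), $$|D^+|^2=|D^-|^2=\tfrac12|D|^2=\tfrac14|\mathring{\mathrm{Ric}}|^2|\nabla f|^2-\tfrac1{48}|R\nabla f-2\nabla R|^2 .$$ -/

import Mathlib

open scoped Manifold ContDiff

/-- The model space of a four-dimensional manifold. -/
abbrev E4 : Type := EuclideanSpace ℝ (Fin 4)

/-! ### Riemannian geometry in local coordinates

`G : E4 → Matrix (Fin 4) (Fin 4) ℝ` is the matrix `g_{ij}` of a Riemannian metric in local
coordinates, and `u : E4 → ℝ` is a function written in these coordinates. -/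

namespace Coord

noncomputable section

/-- Partial derivative `∂_i u` at `x`. -/
def pd (i : Fin 4) (u : E4 → ℝ) (x : E4) : ℝ :=
  fderiv ℝ u x (EuclideanSpace.single i 1)

/-- Inverse metric `g^{ij}`. -/
def ginv (G : E4 → Matrix (Fin 4) (Fin 4) ℝ) (i j : Fin 4) (x : E4) : ℝ :=
  (G x)⁻¹ i j

/-- Christoffel symbols `Γ^k_{ij}` of the Levi-Civita connection. -/
def christoffel (G : E4 → Matrix (Fin 4) (Fin 4) ℝ) (k i j : Fin 4) (x : E4) : ℝ :=
  (1 / 2) * ∑ l, ginv G k l x *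
    (pd i (fun y => G y j l) x + pd j (fun y => G y i l) x - pd l (fun y => G y i j) x)

/-- `R^h_{ijl}`, where `R(∂_i, ∂_j) ∂_l = ∇_i ∇_j ∂_l - ∇_j ∇_i ∂_l = R^h_{ijl} ∂_h`. -/
def riemUp (G : E4 → Matrix (Fin 4) (Fin 4) ℝ) (h i j l : Fin 4) (x : E4) : ℝ :=
  pd i (christoffel G h j l) x - pd j (christoffel G h i l) x
    + ∑ m, (christoffel G h i m x * christoffel G m j l x
        - christoffel G h j m x * christoffel G m i l x)

/-- `R_{ijkl} = g_{hk} R^h_{ijl}`; for orthonormal `e_i, e_j` the sectional curvature is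
`R_{ijij}`. -/
def riem (G : E4 → Matrix (Fin 4) (Fin 4) ℝ) (i j k l : Fin 4) (x : E4) : ℝ :=
  ∑ h, G x h k * riemUp G h i j l x

/-- Ricci curvature `R_{ik} = g^{jl} R_{ijkl}`. -/
def ric (G : E4 → Matrix (Fin 4) (Fin 4) ℝ) (i k : Fin 4) (x : E4) : ℝ :=
  ∑ j, ∑ l, ginv G j l x * riem G i j k l x

/-- Scalar curvature `R = g^{ij} R_{ij}`. -/
def scal (G : E4 → Matrix (Fin 4) (Fin 4) ℝ) (x : E4) : ℝ :=
  ∑ i, ∑ j, ginv G i j x * ric G i j x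

/-- Traceless Ricci curvature. -/
def ric0 (G : E4 → Matrix (Fin 4) (Fin 4) ℝ) (i j : Fin 4) (x : E4) : ℝ :=
  ric G i j x - scal G x / 4 * G x i j

/-- Weyl curvature in dimension four. -/
def weyl (G : E4 → Matrix (Fin 4) (Fin 4) ℝ) (i j k l : Fin 4) (x : E4) : ℝ :=
  riem G i j k l x
    - (1 / 2) * (ric G i k x * G x j l + ric G j l x * G x i k
        - ric G i l x * G x j k - ric G j k x * G x i l)
    + scal G x / 6 * (G x i k * G x j l - G x i l * G x j k)

/-- Hessian `∇_i ∇_j u`. -/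
def hess (G : E4 → Matrix (Fin 4) (Fin 4) ℝ) (u : E4 → ℝ) (i j : Fin 4) (x : E4) : ℝ :=
  pd i (pd j u) x - ∑ k, christoffel G k i j x * pd k u x

/-- Gradient `∇^i u = g^{ij} ∂_j u`. -/
def grad (G : E4 → Matrix (Fin 4) (Fin 4) ℝ) (u : E4 → ℝ) (i : Fin 4) (x : E4) : ℝ :=
  ∑ j, ginv G i j x * pd j u x

/-- Covariant derivative `∇_m T_{ijkl}` of a `(0,4)`-tensor field. -/
def covDeriv (G : E4 → Matrix (Fin 4) (Fin 4) ℝ)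
    (T : Fin 4 → Fin 4 → Fin 4 → Fin 4 → E4 → ℝ) (m i j k l : Fin 4) (x : E4) : ℝ :=
  pd m (T i j k l) x
    - ∑ a, (christoffel G a m i x * T a j k l x + christoffel G a m j x * T i a k l x
        + christoffel G a m k x * T i j a l x + christoffel G a m l x * T i j k a x)

/-- Divergence `(δT)_{jkl} = ∇^i T_{ijkl}` of a `(0,4)`-tensor field. -/
def divergence (G : E4 → Matrix (Fin 4) (Fin 4) ℝ)
    (T : Fin 4 → Fin 4 → Fin 4 → Fin 4 → E4 → ℝ) (j k l : Fin 4) (x : E4) : ℝ :=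
  ∑ i, ∑ m, ginv G i m x * covDeriv G T m i j k l x

/-- The Levi-Civita symbol: the sign of `(i j k l)` if it is a permutation of the four indices,
and `0` otherwise. -/
def eps (i j k l : Fin 4) : ℝ :=
  Matrix.det ((1 : Matrix (Fin 4) (Fin 4) ℝ).submatrix ![i, j, k, l] id)

/-- The Riemannian volume form for the orientation given by the coordinates. -/
def vol (G : E4 → Matrix (Fin 4) (Fin 4) ℝ) (i j k l : Fin 4) (x : E4) : ℝ :=
  Real.sqrt (G x).det * eps i j k l

/-- Hodge star on the last two indices, `½ vol_{klpq} g^{pm} g^{qn} T_{ijmn}`. In a positive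
orthonormal basis it is `T_{ijk'l'}` with `(k l k' l')` an even permutation, for `T` skew in the
last two indices. -/
def starRight (G : E4 → Matrix (Fin 4) (Fin 4) ℝ)
    (T : Fin 4 → Fin 4 → Fin 4 → Fin 4 → E4 → ℝ) (i j k l : Fin 4) (x : E4) : ℝ :=
  (1 / 2) * ∑ p, ∑ q, ∑ m, ∑ n,
    vol G k l p q x * ginv G p m x * ginv G q n x * T i j m n x

/-- Hodge star on the first two indices. -/
def starLeft (G : E4 → Matrix (Fin 4) (Fin 4) ℝ)
    (T : Fin 4 → Fin 4 → Fin 4 → Fin 4 → E4 → ℝ) (i j k l : Fin 4) (x : E4) : ℝ :=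
  (1 / 2) * ∑ p, ∑ q, ∑ m, ∑ n,
    vol G i j p q x * ginv G p m x * ginv G q n x * T m n k l x

/-- The self-dual part (`s = 1`) and the anti-self-dual part (`s = -1`)
`T^± = ¼ (T_{ijkl} ± T_{ijk'l'} ± T_{i'j'kl} + T_{i'j'k'l'})`. -/
def dualPart (s : ℝ) (G : E4 → Matrix (Fin 4) (Fin 4) ℝ)
    (T : Fin 4 → Fin 4 → Fin 4 → Fin 4 → E4 → ℝ) (i j k l : Fin 4) (x : E4) : ℝ :=
  (1 / 4) * (T i j k l x + s * starRight G T i j k l x + s * starLeft G T i j k l x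
    + starLeft G (starRight G T) i j k l x)

/-- The tensor `D_{jkl} = 2 ∇^i W_{ijkl} - W_{ijkl} ∇^i u`. -/
def tensorD (G : E4 → Matrix (Fin 4) (Fin 4) ℝ) (u : E4 → ℝ) (j k l : Fin 4) (x : E4) : ℝ :=
  2 * divergence G (weyl G) j k l x - ∑ i, weyl G i j k l x * grad G u i x

/-- The tensors `D^±_{jkl} = 2 ∇^i W^±_{ijkl} - W^±_{ijkl} ∇^i u`, with `s = ±1`. -/
def tensorDpm (s : ℝ) (G : E4 → Matrix (Fin 4) (Fin 4) ℝ) (u : E4 → ℝ)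
    (j k l : Fin 4) (x : E4) : ℝ :=
  2 * divergence G (dualPart s G (weyl G)) j k l x
    - ∑ i, dualPart s G (weyl G) i j k l x * grad G u i x

/-- `|θ|² = g^{ij} θ_i θ_j`. -/
def normSq1 (G : E4 → Matrix (Fin 4) (Fin 4) ℝ) (θ : Fin 4 → E4 → ℝ) (x : E4) : ℝ :=
  ∑ i, ∑ j, ginv G i j x * θ i x * θ j x

/-- `|A|² = A_{ij} A^{ij}`. -/
def normSq2 (G : E4 → Matrix (Fin 4) (Fin 4) ℝ) (A : Fin 4 → Fin 4 → E4 → ℝ) (x : E4) : ℝ :=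
  ∑ i, ∑ j, ∑ a, ∑ b, ginv G i a x * ginv G j b x * A i j x * A a b x

/-- `|B|² = B_{ijk} B^{ijk}`. -/
def normSq3 (G : E4 → Matrix (Fin 4) (Fin 4) ℝ) (B : Fin 4 → Fin 4 → Fin 4 → E4 → ℝ)
    (x : E4) : ℝ :=
  ∑ i, ∑ j, ∑ k, ∑ a, ∑ b, ∑ c,
    ginv G i a x * ginv G j b x * ginv G k c x * B i j k x * B a b c x

/-- The rows `v a` are the coordinate components of a positive orthonormal basis
`e_a = v_a^i ∂_i` of the tangent space at `x`. -/
def IsPosOrthonormal (G : E4 → Matrix (Fin 4) (Fin 4) ℝ) (x : E4)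
    (v : Matrix (Fin 4) (Fin 4) ℝ) : Prop :=
  (∀ a b, ∑ i, ∑ j, G x i j * v a i * v b j = if a = b then 1 else 0) ∧ 0 < v.det

/-- Components with respect to the vectors `v a`. -/
def inBasis1 (v : Matrix (Fin 4) (Fin 4) ℝ) (θ : Fin 4 → E4 → ℝ) (x : E4) (a : Fin 4) : ℝ :=
  ∑ i, v a i * θ i x

/-- Components with respect to the vectors `v a`. -/
def inBasis2 (v : Matrix (Fin 4) (Fin 4) ℝ) (A : Fin 4 → Fin 4 → E4 → ℝ) (x : E4)
    (a b : Fin 4) : ℝ :=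
  ∑ i, ∑ j, v a i * v b j * A i j x

/-- Components with respect to the vectors `v a`. -/
def inBasis3 (v : Matrix (Fin 4) (Fin 4) ℝ) (B : Fin 4 → Fin 4 → Fin 4 → E4 → ℝ) (x : E4)
    (a b c : Fin 4) : ℝ :=
  ∑ i, ∑ j, ∑ k, v a i * v b j * v c k * B i j k x

end

end Coord

section Manifold4

variable {M : Type*} [TopologicalSpace M] [ChartedSpace E4 M] [IsManifold (𝓡 4) ∞ M]

/-- Smooth Riemannian metrics on `M`. -/
abbrev SmoothMetric (M : Type*) [TopologicalSpace M] [ChartedSpace E4 M]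
    [IsManifold (𝓡 4) ∞ M] : Type _ :=
  Bundle.ContMDiffRiemannianMetric (𝓡 4) ∞ E4 (fun p : M => TangentSpace (𝓡 4) p)

/-- The coordinate vector field `∂_i` of the chart `φ` at the point with coordinates `x`. -/
noncomputable def coordVec (φ : OpenPartialHomeomorph M E4) (i : Fin 4) (x : E4) :
    TangentSpace (𝓡 4) (φ.symm x) :=
  mfderiv 𝓘(ℝ, E4) (𝓡 4) φ.symm x (EuclideanSpace.single i (1 : ℝ) : E4)

/-- The matrix `g_{ij} = g(∂_i, ∂_j)` of the metric in the chart `φ`; it is meaningful on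
`φ.target`. -/
noncomputable def metricIn (g : SmoothMetric M) (φ : OpenPartialHomeomorph M E4) (x : E4) :
    Matrix (Fin 4) (Fin 4) ℝ :=
  Matrix.of fun i j => g.inner (φ.symm x) (coordVec φ i x) (coordVec φ j x)

/-- The function `f` in the chart `φ`. -/
def funIn (f : M → ℝ) (φ : OpenPartialHomeomorph M E4) (x : E4) : ℝ :=
  f (φ.symm x)

/-- `(M, g, f)` is a gradient Ricci soliton: `f` is smooth and, for some real `λ`, the equation
`Ric + ∇²f = λ g` holds in all local coordinates. -/
def IsGradientRicciSoliton (g : SmoothMetric M) (f : M → ℝ) : Prop :=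
  ContMDiff (𝓡 4) 𝓘(ℝ, ℝ) ∞ f ∧
  ∃ lam : ℝ, ∀ φ ∈ IsManifold.maximalAtlas (𝓡 4) ∞ M, ∀ x ∈ φ.target, ∀ i j : Fin 4,
    Coord.ric (metricIn g φ) i j x + Coord.hess (metricIn g φ) (funIn f φ) i j x
      = lam * metricIn g φ x i j

end Manifold4

/-!
The statement is local: in a chart, the soliton equation is a system of equations between
functions on an open subset of `ℝ⁴`, and everything is tensor calculus with Christoffel symbols.

*The formula for `D`.* The second Bianchi identity (`covRiemUp_cyclic`) gives
`∇^i R_{ijkl} = ∇_k R_{jl} - ∇_l R_{jk}` (`divergence_riem`), and one more contraction gives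
`∇^i R_{ik} = ½ ∇_k R` (`divergence_ric`); hence the divergence of the Weyl tensor is half the
Cotton tensor (`divergence_weyl`). On a soliton, `∇_k R_{jl} - ∇_l R_{jk}` is minus the commutator
of covariant derivatives of `∇f`, so that it equals `R_{ijkl} ∇^i f`
(`covDeriv2_ric_sub_of_soliton`), and its trace is `Ric(∇f) = ½ ∇R` (`ric_grad_of_soliton`).
Inserting the decomposition of the curvature tensor gives `D` (`tensorD_of_soliton`).

*The formula for `D^±`.* The Hodge star on bivectors is parallel (`pd_star`), its square is the
identity (`star_mul_star`), and it commutes with the Weyl operator, because the Weyl tensor is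
trace free and antisymmetrization over five indices vanishes (`eps_schouten`, `starLeft_weyl`).
Hence `W^± = ½ (W ± W*)`, and `D^±` is half the sum of `D` and `±` its dual in the last two indices
(`tensorDpm_eq`). In a positive orthonormal basis the dual replaces a pair by its complement.

*The norms.* In an orthonormal basis the formula for `D` shows that `D` is orthogonal to its dual
(`sum_solitonForm_mul_dual`), since every product of two of its terms pairs a symmetric with a skew
expression. So `|D^±|² = ½ |D|²`, and `|D|²` is expanded with `Ric(∇f) = ½ ∇R`
(`sum_sq_solitonForm`).
-/

/-! ### Partial derivatives and metrics in coordinates -/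

noncomputable section
namespace Coord

theorem pd_congr {a b : E4 → ℝ} {U : Set E4} (hU : IsOpen U) (h : ∀ y ∈ U, a y = b y) {x : E4}
    (hx : x ∈ U) (m : Fin 4) : pd m a x = pd m b x := by
  have : a =ᶠ[nhds x] b := by filter_upwards [hU.mem_nhds hx] with y hy using h y hy
  simp only [pd, this.fderiv_eq]

theorem pd_const (m : Fin 4) (c : ℝ) (x : E4) : pd m (fun _ => c) x = 0 := by
  simp [pd]

theorem pd_neg (m : Fin 4) (a : E4 → ℝ) (x : E4) : pd m (fun z => - a z) x = - pd m a x := by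
  simp [pd]

theorem pd_add {a b : E4 → ℝ} {x : E4} (ha : DifferentiableAt ℝ a x)
    (hb : DifferentiableAt ℝ b x) (m : Fin 4) :
    pd m (fun y => a y + b y) x = pd m a x + pd m b x := by
  simp only [pd, fderiv_fun_add ha hb, _root_.add_apply]

theorem pd_sub {a b : E4 → ℝ} {x : E4} (ha : DifferentiableAt ℝ a x)
    (hb : DifferentiableAt ℝ b x) (m : Fin 4) :
    pd m (fun y => a y - b y) x = pd m a x - pd m b x := by
  simp only [pd, fderiv_fun_sub ha hb, _root_.sub_apply]

theorem pd_mul {a b : E4 → ℝ} {x : E4} (ha : DifferentiableAt ℝ a x)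
    (hb : DifferentiableAt ℝ b x) (m : Fin 4) :
    pd m (fun y => a y * b y) x = pd m a x * b x + a x * pd m b x := by
  simp only [pd, fderiv_fun_mul ha hb, _root_.add_apply,
    _root_.smul_apply, smul_eq_mul]
  ring

theorem pd_const_mul {a : E4 → ℝ} {x : E4} (ha : DifferentiableAt ℝ a x) (c : ℝ) (m : Fin 4) :
    pd m (fun y => c * a y) x = c * pd m a x := by
  rw [pd_mul (differentiableAt_const c) ha, pd_const]; ring

theorem pd_sum {ι : Type*} {s : Finset ι} {a : ι → E4 → ℝ} {x : E4}
    (ha : ∀ i ∈ s, DifferentiableAt ℝ (a i) x) (m : Fin 4) :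
    pd m (fun y => ∑ i ∈ s, a i y) x = ∑ i ∈ s, pd m (a i) x := by
  simp only [pd, fderiv_fun_sum ha, _root_.sum_apply]

/-- The Leibniz rule for a contraction. -/
theorem pd_sum_mul {ι : Type*} {s : Finset ι} {a b : ι → E4 → ℝ} {x : E4}
    (ha : ∀ i, DifferentiableAt ℝ (a i) x) (hb : ∀ i, DifferentiableAt ℝ (b i) x) (m : Fin 4) :
    pd m (fun y => ∑ i ∈ s, a i y * b i y) x
      = ∑ i ∈ s, (pd m (a i) x * b i x + a i x * pd m (b i) x) := by
  rw [pd_sum (a := fun i y => a i y * b i y) fun i _ => (ha i).mul (hb i)]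
  exact Finset.sum_congr rfl fun i _ => pd_mul (ha i) (hb i) m

theorem pd_comm {a : E4 → ℝ} {x : E4} (ha : ContDiffAt ℝ ∞ a x) (i j : Fin 4) :
    pd i (pd j a) x = pd j (pd i a) x := by
  have hs : IsSymmSndFDerivAt ℝ a x := ha.isSymmSndFDerivAt
    (by simpa using (WithTop.coe_le_coe.2 le_top : ((2 : ℕ∞) : ℕ∞ω) ≤ ∞))
  have hd : DifferentiableAt ℝ (fderiv ℝ a) x :=
    (ha.fderiv_right (m := 1) (WithTop.coe_le_coe.2 le_top)).differentiableAt (by simp)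
  have key : ∀ p q : Fin 4, pd p (pd q a) x
      = fderiv ℝ (fderiv ℝ a) x (EuclideanSpace.single p 1) (EuclideanSpace.single q 1) := by
    intro p q
    simp only [pd]
    change fderiv ℝ (fun y => fderiv ℝ a y (EuclideanSpace.single q 1)) x _ = _
    rw [fderiv_clm_apply hd (differentiableAt_const _)]
    simp
  rw [key, key]
  exact hs _ _

theorem contDiffOn_pd {a : E4 → ℝ} {U : Set E4} (hU : IsOpen U) (ha : ContDiffOn ℝ ∞ a U)
    (m : Fin 4) : ContDiffOn ℝ ∞ (pd m a) U :=
  (ha.fderiv_of_isOpen hU (by simp)).clm_apply contDiffOn_const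

theorem contDiffOn_det {n : ℕ} {A : E4 → Matrix (Fin n) (Fin n) ℝ} {U : Set E4}
    (hA : ∀ i j, ContDiffOn ℝ ∞ (fun y => A y i j) U) :
    ContDiffOn ℝ ∞ (fun y => (A y).det) U := by
  simp only [Matrix.det_apply']
  exact ContDiffOn.sum fun σ _ => contDiffOn_const.mul (contDiffOn_prod fun i _ => hA _ _)

/-- Jacobi's formula for the derivative of a determinant. -/
theorem pd_det {A : E4 → Matrix (Fin 4) (Fin 4) ℝ} {x : E4}
    (hA : ∀ i j, DifferentiableAt ℝ (fun y => A y i j) x) (m : Fin 4) :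
    pd m (fun y => (A y).det) x
      = ((A x).adjugate * Matrix.of fun i j => pd m (fun y => A y i j) x).trace := by
  have h1 : ∀ i, ((A x).adjugate * Matrix.of fun i j => pd m (fun y => A y i j) x) i i
      = ((A x).updateCol i (fun k => pd m (fun y => A y k i) x)).det := by
    intro i
    rw [← Matrix.cramer_apply, Matrix.cramer_eq_adjugate_mulVec]
    rfl
  simp only [Matrix.trace, Matrix.diag, h1]
  simp only [Matrix.det_apply']
  have hprod : ∀ σ : Equiv.Perm (Fin 4), HasFDerivAt (fun y => ∏ i, A y (σ i) i) _ x := fun σ =>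
    HasFDerivAt.finsetProd (u := Finset.univ) fun i _ => (hA (σ i) i).hasFDerivAt
  rw [pd_sum (a := fun σ y => ((Equiv.Perm.sign σ : ℤ) : ℝ) * ∏ i, A y (σ i) i)
    fun σ _ => (differentiableAt_const _).mul (hprod σ).differentiableAt, Finset.sum_comm]
  refine Finset.sum_congr rfl fun σ _ => ?_
  rw [pd_const_mul (hprod σ).differentiableAt, ← Finset.mul_sum]
  congr 1
  simp only [pd, (hprod σ).fderiv, _root_.sum_apply, _root_.smul_apply,
    smul_eq_mul]
  refine Finset.sum_congr rfl fun i _ => ?_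
  rw [← Finset.mul_prod_erase Finset.univ _ (Finset.mem_univ i), mul_comm]
  congr 1
  · simp
  · refine Finset.prod_congr rfl fun j hj => ?_
    rw [Matrix.updateCol_ne (Finset.ne_of_mem_erase hj)]

/-- `G` is, on the open set `U`, the coordinate matrix of a smooth Riemannian metric. -/
structure IsMetricOn (G : E4 → Matrix (Fin 4) (Fin 4) ℝ) (U : Set E4) : Prop where
  isOpen : IsOpen U
  contDiffOn : ∀ i j, ContDiffOn ℝ ∞ (fun y => G y i j) U
  symm : ∀ y i j, G y i j = G y j i
  posDef : ∀ y ∈ U, (G y).PosDef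

namespace IsMetricOn

variable {G : E4 → Matrix (Fin 4) (Fin 4) ℝ} {U : Set E4} {y : E4}

theorem ginv_symm (h : IsMetricOn G U) (i j : Fin 4) (y : E4) : ginv G i j y = ginv G j i y := by
  have : (G y).transpose = G y := by ext i j; exact h.symm y j i
  conv_lhs => rw [ginv, ← this, ← Matrix.transpose_nonsing_inv]
  rfl

theorem det_pos (h : IsMetricOn G U) (hy : y ∈ U) : 0 < (G y).det := (h.posDef y hy).det_pos

theorem sum_ginv_mul (h : IsMetricOn G U) (hy : y ∈ U) (i k : Fin 4) :
    ∑ j, ginv G i j y * G y j k = if i = k then 1 else 0 := by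
  have := Matrix.nonsing_inv_mul (G y) (h.det_pos hy).ne'.isUnit
  simpa [Matrix.mul_apply, Matrix.one_apply, ginv] using congrFun (congrFun this i) k

theorem sum_mul_ginv (h : IsMetricOn G U) (hy : y ∈ U) (i k : Fin 4) :
    ∑ j, G y i j * ginv G j k y = if i = k then 1 else 0 := by
  have := Matrix.mul_nonsing_inv (G y) (h.det_pos hy).ne'.isUnit
  simpa [Matrix.mul_apply, Matrix.one_apply, ginv] using congrFun (congrFun this i) k

theorem contDiffOn_ginv (h : IsMetricOn G U) (i j : Fin 4) : ContDiffOn ℝ ∞ (ginv G i j) U := by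
  have hd := contDiffOn_det h.contDiffOn
  have ha : ContDiffOn ℝ ∞ (fun y => (G y).adjugate i j) U := by
    simp only [Matrix.adjugate_apply]
    refine contDiffOn_det fun a b => ?_
    by_cases hab : a = j
    · simp only [hab, Matrix.updateRow_self]; exact contDiffOn_const
    · simp only [Matrix.updateRow_ne hab]; exact h.contDiffOn a b
  refine ((hd.inv fun y hy => (h.det_pos hy).ne').mul ha).congr fun y hy => ?_
  simp [ginv, Matrix.inv_def, Ring.inverse_eq_inv']

theorem contDiffOn_sqrt_det (h : IsMetricOn G U) :
    ContDiffOn ℝ ∞ (fun y => Real.sqrt (G y).det) U :=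
  (contDiffOn_det h.contDiffOn).sqrt fun _ hy => (h.det_pos hy).ne'

theorem contDiffOn_christoffel (h : IsMetricOn G U) (k i j : Fin 4) :
    ContDiffOn ℝ ∞ (christoffel G k i j) U :=
  contDiffOn_const.mul (ContDiffOn.sum fun l _ => (h.contDiffOn_ginv k l).mul
    (((contDiffOn_pd h.isOpen (h.contDiffOn j l) i).add
      (contDiffOn_pd h.isOpen (h.contDiffOn i l) j)).sub
      (contDiffOn_pd h.isOpen (h.contDiffOn i j) l)))

theorem contDiffOn_riemUp (h : IsMetricOn G U) (k i j l : Fin 4) :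
    ContDiffOn ℝ ∞ (riemUp G k i j l) U :=
  ((contDiffOn_pd h.isOpen (h.contDiffOn_christoffel k j l) i).sub
    (contDiffOn_pd h.isOpen (h.contDiffOn_christoffel k i l) j)).add
    (ContDiffOn.sum fun _ _ =>
      ((h.contDiffOn_christoffel _ _ _).mul (h.contDiffOn_christoffel _ _ _)).sub
        ((h.contDiffOn_christoffel _ _ _).mul (h.contDiffOn_christoffel _ _ _)))

theorem contDiffOn_riem (h : IsMetricOn G U) (i j k l : Fin 4) :
    ContDiffOn ℝ ∞ (riem G i j k l) U :=
  ContDiffOn.sum fun _ _ => (h.contDiffOn _ _).mul (h.contDiffOn_riemUp _ _ _ _)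

theorem contDiffOn_ric (h : IsMetricOn G U) (i k : Fin 4) : ContDiffOn ℝ ∞ (ric G i k) U :=
  ContDiffOn.sum fun _ _ => ContDiffOn.sum fun _ _ =>
    (h.contDiffOn_ginv _ _).mul (h.contDiffOn_riem _ _ _ _)

theorem contDiffOn_scal (h : IsMetricOn G U) : ContDiffOn ℝ ∞ (scal G) U :=
  ContDiffOn.sum fun _ _ => ContDiffOn.sum fun _ _ =>
    (h.contDiffOn_ginv _ _).mul (h.contDiffOn_ric _ _)

theorem contDiffOn_weyl (h : IsMetricOn G U) (i j k l : Fin 4) :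
    ContDiffOn ℝ ∞ (weyl G i j k l) U :=
  ((h.contDiffOn_riem i j k l).sub (contDiffOn_const.mul
    (((((h.contDiffOn_ric _ _).mul (h.contDiffOn _ _)).add
      ((h.contDiffOn_ric _ _).mul (h.contDiffOn _ _))).sub
      ((h.contDiffOn_ric _ _).mul (h.contDiffOn _ _))).sub
      ((h.contDiffOn_ric _ _).mul (h.contDiffOn _ _))))).add
  ((h.contDiffOn_scal.div_const 6).mul
    (((h.contDiffOn _ _).mul (h.contDiffOn _ _)).sub
      ((h.contDiffOn _ _).mul (h.contDiffOn _ _))))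

theorem differentiableAt (h : IsMetricOn G U) (hy : y ∈ U) {a : E4 → ℝ}
    (ha : ContDiffOn ℝ ∞ a U) : DifferentiableAt ℝ a y :=
  (ha.contDiffAt (h.isOpen.mem_nhds hy)).differentiableAt (by simp)

end IsMetricOn
end Coord
end

/-! ### The Levi-Civita connection and the algebraic symmetries of curvature -/

noncomputable section
namespace Coord
namespace IsMetricOn

variable {G : E4 → Matrix (Fin 4) (Fin 4) ℝ} {U : Set E4} {y : E4}

theorem pd_metric_symm (h : IsMetricOn G U) (m i j : Fin 4) :
    pd m (fun z => G z i j) = pd m (fun z => G z j i) := by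
  simp only [h.symm _ i j]

theorem christoffel_symm (h : IsMetricOn G U) (k i j : Fin 4) :
    christoffel G k i j = christoffel G k j i := by
  funext z
  simp only [christoffel, h.pd_metric_symm _ i j]
  congr 1
  refine Finset.sum_congr rfl fun l _ => ?_
  ring

theorem sum_metric_mul_christoffel (h : IsMetricOn G U) (hy : y ∈ U) (k i j : Fin 4) :
    ∑ a, G y k a * christoffel G a i j y
      = (1 / 2) * (pd i (fun z => G z j k) y + pd j (fun z => G z i k) y
          - pd k (fun z => G z i j) y) := by
  simp only [christoffel, Finset.mul_sum]
  rw [Finset.sum_comm]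
  have : ∀ l, ∑ a, G y k a * ((1 / 2) * (ginv G a l y * (pd i (fun z => G z j l) y
      + pd j (fun z => G z i l) y - pd l (fun z => G z i j) y)))
      = (∑ a, G y k a * ginv G a l y) * ((1 / 2) * (pd i (fun z => G z j l) y
      + pd j (fun z => G z i l) y - pd l (fun z => G z i j) y)) := by
    intro l
    rw [Finset.sum_mul]
    exact Finset.sum_congr rfl fun a _ => by ring
  simp only [this, h.sum_mul_ginv hy, ite_mul, one_mul, zero_mul, Finset.sum_ite_eq,
    Finset.mem_univ, if_true]

/-- The metric is parallel. -/
theorem pd_metric (h : IsMetricOn G U) (hy : y ∈ U) (m i j : Fin 4) :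
    pd m (fun z => G z i j) y
      = ∑ a, (christoffel G a m i y * G y a j + christoffel G a m j y * G y i a) := by
  have h1 := h.sum_metric_mul_christoffel hy j m i
  have h2 := h.sum_metric_mul_christoffel hy i m j
  rw [Finset.sum_add_distrib]
  have e1 : ∑ a, christoffel G a m i y * G y a j = ∑ a, G y j a * christoffel G a m i y :=
    Finset.sum_congr rfl fun a _ => by rw [h.symm y a j, mul_comm]
  have e2 : ∑ a, christoffel G a m j y * G y i a = ∑ a, G y i a * christoffel G a m j y :=
    Finset.sum_congr rfl fun a _ => by rw [mul_comm]
  rw [e1, e2, h1, h2, h.pd_metric_symm m j i, h.pd_metric_symm i m j, h.pd_metric_symm j m i]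
  ring

/-- The inverse metric is parallel. -/
theorem pd_ginv (h : IsMetricOn G U) (hy : y ∈ U) (m i j : Fin 4) :
    pd m (ginv G i j) y
      = - ∑ a, (christoffel G i m a y * ginv G a j y + christoffel G j m a y * ginv G i a y) := by
  let P : Matrix (Fin 4) (Fin 4) ℝ := Matrix.of fun i j => pd m (ginv G i j) y
  let C : Matrix (Fin 4) (Fin 4) ℝ := Matrix.of fun i j => christoffel G i m j y
  have hH : G y * (G y)⁻¹ = 1 := Matrix.mul_nonsing_inv _ (h.det_pos hy).ne'.isUnit
  have hH' : (G y)⁻¹ * G y = 1 := Matrix.nonsing_inv_mul _ (h.det_pos hy).ne'.isUnit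
  have h0 : P * G y + (G y)⁻¹ * (C.transpose * G y + G y * C) = 0 := by
    ext i k
    have hc : pd m (fun z => ∑ j, ginv G i j z * G z j k) y = 0 := by
      rw [pd_congr h.isOpen (fun z hz => h.sum_ginv_mul hz i k) hy, pd_const]
    rw [pd_sum_mul (fun j => h.differentiableAt hy (h.contDiffOn_ginv i j))
      (fun j => h.differentiableAt hy (h.contDiffOn j k))] at hc
    simp only [h.pd_metric hy] at hc
    simp only [Matrix.add_apply, Matrix.mul_apply, Matrix.transpose_apply, Matrix.zero_apply,
      P, C, Matrix.of_apply, ← Finset.sum_add_distrib]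
    rw [← hc]
    refine Finset.sum_congr rfl fun j _ => ?_
    simp only [ginv, mul_comm (G y j _)]
  have h1 : P = -(C * (G y)⁻¹ + (G y)⁻¹ * C.transpose) := by
    have : (P * G y + (G y)⁻¹ * (C.transpose * G y + G y * C)) * (G y)⁻¹ = 0 := by
      rw [h0, zero_mul]
    rw [add_mul, mul_assoc, hH, mul_one, mul_add, ← mul_assoc (G y)⁻¹ (G y), hH', one_mul,
      add_mul, mul_assoc, mul_assoc, hH, mul_one] at this
    rw [eq_neg_iff_add_eq_zero, add_comm (C * _)]
    exact this
  have := congrFun (congrFun h1 i) j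
  simp only [P, C, Matrix.of_apply, Matrix.neg_apply, Matrix.add_apply, Matrix.mul_apply,
    Matrix.transpose_apply, ← Finset.sum_add_distrib] at this
  rw [this]
  congr 1
  exact Finset.sum_congr rfl fun a _ => by simp only [ginv]; ring

theorem riemUp_antisymm (k i j l : Fin 4) : riemUp G k i j l = fun z => - riemUp G k j i l z := by
  funext z
  simp only [riemUp, Fin.sum_univ_four]
  ring

/-- The first Bianchi identity. -/
theorem riemUp_cyclic (h : IsMetricOn G U) (k i j l : Fin 4) (y : E4) :
    riemUp G k i j l y + riemUp G k j l i y + riemUp G k l i j y = 0 := by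
  simp only [riemUp, h.christoffel_symm _ l i, h.christoffel_symm _ l j, h.christoffel_symm _ j i,
    Fin.sum_univ_four]
  ring

theorem riem_antisymm_left (i j k l : Fin 4) : riem G i j k l = fun z => - riem G j i k l z := by
  funext z
  simp only [riem, riemUp_antisymm _ i j l, mul_neg, Finset.sum_neg_distrib]

theorem riem_cyclic (h : IsMetricOn G U) (i j k l : Fin 4) (y : E4) :
    riem G i j k l y + riem G j l k i y + riem G l i k j y = 0 := by
  simp only [riem, ← Finset.sum_add_distrib, ← mul_add, h.riemUp_cyclic, mul_zero,
    Finset.sum_const_zero]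

theorem riem_antisymm_right (h : IsMetricOn G U) (hy : y ∈ U) (i j k l : Fin 4) :
    riem G i j k l y = - riem G i j l k y := by
  have key : ∀ i j : Fin 4, pd i (pd j fun z => G z k l) y = ∑ a,
      (pd i (christoffel G a j k) y * G y a l
        + christoffel G a j k y * ∑ b, (christoffel G b i a y * G y b l
            + christoffel G b i l y * G y a b)
        + (pd i (christoffel G a j l) y * G y k a
        + christoffel G a j l y * ∑ b, (christoffel G b i k y * G y b a
            + christoffel G b i a y * G y k b))) := by
    intro i j
    have dΓ := fun a b c => h.differentiableAt hy (h.contDiffOn_christoffel a b c)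
    have dG := fun a b => h.differentiableAt hy (h.contDiffOn a b)
    rw [pd_congr h.isOpen (fun z hz => h.pd_metric hz j k l) hy,
      pd_sum (a := fun a z => christoffel G a j k z * G z a l + christoffel G a j l z * G z k a)
        fun a _ => ((dΓ _ _ _).fun_mul (dG _ _)).add ((dΓ _ _ _).fun_mul (dG _ _))]
    refine Finset.sum_congr rfl fun a _ => ?_
    rw [pd_add ((dΓ _ _ _).fun_mul (dG _ _)) ((dΓ _ _ _).fun_mul (dG _ _)),
      pd_mul (dΓ _ _ _) (dG _ _), pd_mul (dΓ _ _ _) (dG _ _), h.pd_metric hy, h.pd_metric hy]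
  have hc := pd_comm ((h.contDiffOn k l).contDiffAt (h.isOpen.mem_nhds hy)) i j
  rw [key, key] at hc
  simp only [riem, riemUp, Fin.sum_univ_four] at hc ⊢
  simp only [h.symm y 1 0, h.symm y 2 0, h.symm y 3 0, h.symm y 2 1, h.symm y 3 1, h.symm y 3 2,
    h.symm y k] at hc ⊢
  linear_combination hc

theorem riem_pair_symm (h : IsMetricOn G U) (hy : y ∈ U) (i j k l : Fin 4) :
    riem G i j k l y = riem G k l i j y := by
  have a : ∀ i j k l, riem G i j k l y = - riem G j i k l y := fun i j k l =>
    congrFun (riem_antisymm_left i j k l) y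
  have b := h.riem_antisymm_right hy
  have c := fun i j k l => h.riem_cyclic i j k l y
  have c1 := c i j k l
  have c2 := c j k l i
  have c3 := c k l i j
  have c4 := c l i j k
  simp only [b _ _ l i, b _ _ k i, b _ _ l j, b _ _ k j, b _ _ l k, b _ _ j i,
    a l i, a k i, a l j] at c1 c2 c3 c4 ⊢
  linarith

end IsMetricOn
end Coord
end

/-! ### Covariant derivatives and the second Bianchi identity -/

noncomputable section
namespace Coord

/-- Covariant derivative `∇_m A_{ij}` of a `(0,2)`-tensor field. -/
def covDeriv2 (G : E4 → Matrix (Fin 4) (Fin 4) ℝ) (A : Fin 4 → Fin 4 → E4 → ℝ)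
    (m i j : Fin 4) (x : E4) : ℝ :=
  pd m (A i j) x - ∑ a, (christoffel G a m i x * A a j x + christoffel G a m j x * A i a x)

/-- Covariant derivative `∇_m R^h_{ijl}` of the curvature tensor. -/
def covRiemUp (G : E4 → Matrix (Fin 4) (Fin 4) ℝ) (m h i j l : Fin 4) (x : E4) : ℝ :=
  pd m (riemUp G h i j l) x
    + ∑ a, (christoffel G h m a x * riemUp G a i j l x
        - christoffel G a m i x * riemUp G h a j l x
        - christoffel G a m j x * riemUp G h i a l x
        - christoffel G a m l x * riemUp G h i j a x)

namespace IsMetricOn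

variable {G : E4 → Matrix (Fin 4) (Fin 4) ℝ} {U : Set E4} {y : E4}

theorem pd_riemUp (h : IsMetricOn G U) (hy : y ∈ U) (m k i j l : Fin 4) :
    pd m (riemUp G k i j l) y
      = pd m (pd i (christoffel G k j l)) y - pd m (pd j (christoffel G k i l)) y
        + ∑ b, (pd m (christoffel G k i b) y * christoffel G b j l y
          + christoffel G k i b y * pd m (christoffel G b j l) y
          - (pd m (christoffel G k j b) y * christoffel G b i l y
          + christoffel G k j b y * pd m (christoffel G b i l) y)) := by
  have dΓ := fun a b c => h.differentiableAt hy (h.contDiffOn_christoffel a b c)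
  have dΓ' := fun e a b c => h.differentiableAt hy
    (contDiffOn_pd h.isOpen (h.contDiffOn_christoffel a b c) e)
  have dS := fun b => ((dΓ k i b).fun_mul (dΓ b j l)).fun_sub ((dΓ k j b).fun_mul (dΓ b i l))
  change pd m (fun z => pd i (christoffel G k j l) z - pd j (christoffel G k i l) z
    + ∑ b, (christoffel G k i b z * christoffel G b j l z
        - christoffel G k j b z * christoffel G b i l z)) y = _
  rw [pd_add ((dΓ' _ _ _ _).fun_sub (dΓ' _ _ _ _)) (DifferentiableAt.fun_sum fun b _ => dS b),
    pd_sub (dΓ' _ _ _ _) (dΓ' _ _ _ _),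
    pd_sum (a := fun b z => christoffel G k i b z * christoffel G b j l z
        - christoffel G k j b z * christoffel G b i l z) (fun b _ => dS b)]
  congr 1
  refine Finset.sum_congr rfl fun b _ => ?_
  rw [pd_sub ((dΓ _ _ _).fun_mul (dΓ _ _ _)) ((dΓ _ _ _).fun_mul (dΓ _ _ _)),
    pd_mul (dΓ _ _ _) (dΓ _ _ _), pd_mul (dΓ _ _ _) (dΓ _ _ _)]

/-- The second Bianchi identity. -/
theorem covRiemUp_cyclic (h : IsMetricOn G U) (hy : y ∈ U) (k m i j l : Fin 4) :
    covRiemUp G m k i j l y + covRiemUp G i k j m l y + covRiemUp G j k m i l y = 0 := by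
  have hsm : ∀ a b c, ContDiffAt ℝ ∞ (christoffel G a b c) y := fun a b c =>
    (h.contDiffOn_christoffel a b c).contDiffAt (h.isOpen.mem_nhds hy)
  -- The Jacobi identity for the curvature of a matrix-valued connection form.
  have hJ : ∀ e, (pd m (riemUp G k i j e) y + ∑ a, (christoffel G k m a y * riemUp G a i j e y
        - christoffel G a m e y * riemUp G k i j a y))
      + (pd i (riemUp G k j m e) y + ∑ a, (christoffel G k i a y * riemUp G a j m e y
        - christoffel G a i e y * riemUp G k j m a y))
      + (pd j (riemUp G k m i e) y + ∑ a, (christoffel G k j a y * riemUp G a m i e y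
        - christoffel G a j e y * riemUp G k m i a y)) = 0 := by
    intro e
    simp only [h.pd_riemUp hy]
    rw [pd_comm (hsm k j e) m i, pd_comm (hsm k i e) m j, pd_comm (hsm k m e) i j]
    simp only [riemUp, Fin.sum_univ_four]
    ring
  -- The remaining Christoffel terms cancel in pairs since the connection is torsion free.
  have hc : ∀ p q r, ∑ a, christoffel G a p q y * riemUp G k a r l y
      + ∑ a, christoffel G a q p y * riemUp G k r a l y = 0 := by
    intro p q r
    rw [← Finset.sum_add_distrib]
    refine Finset.sum_eq_zero fun a _ => ?_
    rw [h.christoffel_symm a p q, riemUp_antisymm k a r l]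
    ring
  have hT := hJ l
  simp only [covRiemUp, Finset.sum_sub_distrib] at hT ⊢
  linear_combination hT - hc m i j - hc i j m - hc j m i

/-- Lowering an index commutes with covariant differentiation. -/
theorem covDeriv_riem (h : IsMetricOn G U) (hy : y ∈ U) (m i j k l : Fin 4) :
    covDeriv G (riem G) m i j k l y = ∑ e, G y e k * covRiemUp G m e i j l y := by
  have h1 : pd m (riem G i j k l) y = _ :=
    pd_sum_mul (fun e => h.differentiableAt hy (h.contDiffOn e k))
      (fun e => h.differentiableAt hy (h.contDiffOn_riemUp e i j l)) m
  rw [covDeriv, h1]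
  simp only [h.pd_metric hy, covRiemUp, riem, Fin.sum_univ_four]
  ring

theorem covDeriv_riem_cyclic (h : IsMetricOn G U) (hy : y ∈ U) (m i j k l : Fin 4) :
    covDeriv G (riem G) m i j k l y + covDeriv G (riem G) i j m k l y
      + covDeriv G (riem G) j m i k l y = 0 := by
  simp only [h.covDeriv_riem hy, ← Finset.sum_add_distrib, ← mul_add, h.covRiemUp_cyclic hy,
    mul_zero, Finset.sum_const_zero]

theorem covDeriv_riem_pair_symm (h : IsMetricOn G U) (hy : y ∈ U) (m i j k l : Fin 4) :
    covDeriv G (riem G) m i j k l y = covDeriv G (riem G) m k l i j y := by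
  simp only [covDeriv]
  rw [pd_congr h.isOpen (fun z hz => h.riem_pair_symm hz i j k l) hy]
  congr 1
  refine Finset.sum_congr rfl fun a _ => ?_
  rw [h.riem_pair_symm hy a j, h.riem_pair_symm hy i a, h.riem_pair_symm hy i j a,
    h.riem_pair_symm hy i j k a]
  ring

theorem covDeriv_riem_antisymm_left (m i j k l : Fin 4) :
    covDeriv G (riem G) m i j k l y = - covDeriv G (riem G) m j i k l y := by
  simp only [covDeriv, Fin.sum_univ_four]
  rw [riem_antisymm_left i j k l, pd_neg]
  have a : ∀ i j k l, riem G i j k l y = - riem G j i k l y := fun i j k l =>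
    congrFun (riem_antisymm_left i j k l) y
  simp only [a _ j, a i]
  ring

theorem covDeriv_riem_antisymm_right (h : IsMetricOn G U) (hy : y ∈ U) (m i j k l : Fin 4) :
    covDeriv G (riem G) m i j k l y = - covDeriv G (riem G) m i j l k y := by
  rw [h.covDeriv_riem_pair_symm hy, covDeriv_riem_antisymm_left, h.covDeriv_riem_pair_symm hy]

/-- Covariant differentiation commutes with the contraction of the second and the last index. -/
theorem covDeriv2_trace (h : IsMetricOn G U) (hy : y ∈ U)
    {T : Fin 4 → Fin 4 → Fin 4 → Fin 4 → E4 → ℝ}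
    (hT : ∀ i j k l, DifferentiableAt ℝ (T i j k l) y) (m i k : Fin 4) :
    covDeriv2 G (fun i k z => ∑ j, ∑ l, ginv G j l z * T i j k l z) m i k y
      = ∑ j, ∑ l, ginv G j l y * covDeriv G T m i j k l y := by
  have dH := fun i j => h.differentiableAt hy (h.contDiffOn_ginv i j)
  have h1 : pd m (fun z => ∑ j, ∑ l, ginv G j l z * T i j k l z) y
      = ∑ j, ∑ l, (pd m (ginv G j l) y * T i j k l y + ginv G j l y * pd m (T i j k l) y) := by
    rw [pd_sum (a := fun j z => ∑ l, ginv G j l z * T i j k l z)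
      fun j _ => DifferentiableAt.fun_sum fun l _ => (dH j l).fun_mul (hT i j k l)]
    exact Finset.sum_congr rfl fun j _ => pd_sum_mul (fun l => dH j l) (fun l => hT i j k l) m
  rw [covDeriv2, h1]
  simp only [h.pd_ginv hy, covDeriv, Fin.sum_univ_four]
  ring

/-- Covariant differentiation commutes with the full contraction of a `(0,2)`-tensor field. -/
theorem pd_trace (h : IsMetricOn G U) (hy : y ∈ U) {A : Fin 4 → Fin 4 → E4 → ℝ}
    (hA : ∀ i j, DifferentiableAt ℝ (A i j) y) (m : Fin 4) :
    pd m (fun z => ∑ i, ∑ j, ginv G i j z * A i j z) y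
      = ∑ i, ∑ j, ginv G i j y * covDeriv2 G A m i j y := by
  have dH := fun i j => h.differentiableAt hy (h.contDiffOn_ginv i j)
  have h1 : pd m (fun z => ∑ i, ∑ j, ginv G i j z * A i j z) y
      = ∑ i, ∑ j, (pd m (ginv G i j) y * A i j y + ginv G i j y * pd m (A i j) y) := by
    rw [pd_sum (a := fun i z => ∑ j, ginv G i j z * A i j z)
      fun i _ => DifferentiableAt.fun_sum fun j _ => (dH i j).fun_mul (hA i j)]
    exact Finset.sum_congr rfl fun i _ => pd_sum_mul (fun j => dH i j) (fun j => hA i j) m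
  rw [h1]
  simp only [h.pd_ginv hy, covDeriv2, Fin.sum_univ_four]
  ring

end IsMetricOn
end Coord
end

/-! ### Divergence of the Weyl tensor and the soliton equation -/

noncomputable section
namespace Coord
namespace IsMetricOn

variable {G : E4 → Matrix (Fin 4) (Fin 4) ℝ} {U : Set E4} {y : E4}

theorem ric_symm (h : IsMetricOn G U) (hy : y ∈ U) (i k : Fin 4) : ric G i k y = ric G k i y := by
  simp only [ric]
  rw [Finset.sum_comm]
  refine Finset.sum_congr rfl fun l _ => Finset.sum_congr rfl fun j _ => ?_
  rw [h.ginv_symm j l, h.riem_pair_symm hy]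

theorem covDeriv2_symm (h : IsMetricOn G U) (hy : y ∈ U) {A : Fin 4 → Fin 4 → E4 → ℝ}
    (hA : ∀ z ∈ U, ∀ i j, A i j z = A j i z) (m i j : Fin 4) :
    covDeriv2 G A m i j y = covDeriv2 G A m j i y := by
  simp only [covDeriv2]
  rw [pd_congr h.isOpen (fun z hz => hA z hz i j) hy]
  congr 1
  refine Finset.sum_congr rfl fun a _ => ?_
  rw [hA y hy a j, hA y hy i a]
  ring

theorem covDeriv2_ric (h : IsMetricOn G U) (hy : y ∈ U) (m i k : Fin 4) :
    covDeriv2 G (ric G) m i k y = ∑ j, ∑ l, ginv G j l y * covDeriv G (riem G) m i j k l y :=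
  h.covDeriv2_trace hy (fun i j k l => h.differentiableAt hy (h.contDiffOn_riem i j k l)) m i k

theorem pd_scal (h : IsMetricOn G U) (hy : y ∈ U) (m : Fin 4) :
    pd m (scal G) y = ∑ i, ∑ j, ginv G i j y * covDeriv2 G (ric G) m i j y :=
  h.pd_trace hy (fun i j => h.differentiableAt hy (h.contDiffOn_ric i j)) m

/-- The divergence of the curvature tensor is the exterior covariant derivative of the Ricci
tensor. -/
theorem divergence_riem (h : IsMetricOn G U) (hy : y ∈ U) (j k l : Fin 4) :
    divergence G (riem G) j k l y = covDeriv2 G (ric G) k j l y - covDeriv2 G (ric G) l j k y := by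
  simp only [h.covDeriv2_ric hy, divergence, ← Finset.sum_sub_distrib, ← mul_sub]
  refine Finset.sum_congr rfl fun i _ => Finset.sum_congr rfl fun m _ => ?_
  congr 1
  have h1 := h.covDeriv_riem_cyclic hy m k l i j
  rw [h.covDeriv_riem_pair_symm hy m k l, h.covDeriv_riem_pair_symm hy k l m,
    h.covDeriv_riem_pair_symm hy l m k] at h1
  rw [covDeriv_riem_antisymm_left k j i, covDeriv_riem_antisymm_left l j i,
    h.covDeriv_riem_antisymm_right hy l i j k m]
  linear_combination h1

/-- The twice contracted second Bianchi identity `∇^i R_{ik} = ½ ∇_k R`. -/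
theorem divergence_ric (h : IsMetricOn G U) (hy : y ∈ U) (k : Fin 4) :
    ∑ i, ∑ m, ginv G i m y * covDeriv2 G (ric G) m i k y = (1 / 2) * pd k (scal G) y := by
  have h1 : ∑ j, ∑ l, ginv G j l y * divergence G (riem G) j k l y
      = ∑ i, ∑ m, ginv G i m y * covDeriv2 G (ric G) m i k y := by
    simp only [h.covDeriv2_ric hy, divergence, Finset.mul_sum]
    simp only [Fin.sum_univ_four]
    ring
  simp only [h.divergence_riem hy, mul_sub, Finset.sum_sub_distrib] at h1
  rw [← h.pd_scal hy] at h1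
  linarith

theorem sum_ginv_mul_metric (h : IsMetricOn G U) (hy : y ∈ U) (X : Fin 4 → ℝ) (k : Fin 4) :
    ∑ i, ∑ m, ginv G i m y * (X m * G y i k) = X k := by
  have : ∀ m, ∑ i, ginv G i m y * (X m * G y i k) = X m * ∑ i, ginv G m i y * G y i k := by
    intro m
    rw [Finset.mul_sum]
    refine Finset.sum_congr rfl fun i _ => ?_
    rw [h.ginv_symm i m]; ring
  rw [Finset.sum_comm]
  simp only [this, h.sum_ginv_mul hy, mul_ite, mul_one, mul_zero, Finset.sum_ite_eq',
    Finset.mem_univ, if_true]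

theorem sum_metric_mul_grad (h : IsMetricOn G U) (hy : y ∈ U) (u : E4 → ℝ) (k : Fin 4) :
    ∑ i, G y i k * grad G u i y = pd k u y := by
  rw [← h.sum_ginv_mul_metric hy (fun m => pd m u y) k]
  simp only [grad, Finset.mul_sum]
  exact Finset.sum_congr rfl fun i _ => Finset.sum_congr rfl fun m _ => by ring

/-- The covariant derivative of the Weyl tensor, the metric being parallel. -/
theorem covDeriv_weyl (h : IsMetricOn G U) (hy : y ∈ U) (m i j k l : Fin 4) :
    covDeriv G (weyl G) m i j k l y = covDeriv G (riem G) m i j k l y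
      - (1 / 2) * (covDeriv2 G (ric G) m i k y * G y j l + covDeriv2 G (ric G) m j l y * G y i k
        - covDeriv2 G (ric G) m i l y * G y j k - covDeriv2 G (ric G) m j k y * G y i l)
      + pd m (scal G) y / 6 * (G y i k * G y j l - G y i l * G y j k) := by
  have dG := fun i j => h.differentiableAt hy (h.contDiffOn i j)
  have dR := fun i j => h.differentiableAt hy (h.contDiffOn_ric i j)
  have dRm := h.differentiableAt hy (h.contDiffOn_riem i j k l)
  have dS := h.differentiableAt hy h.contDiffOn_scal
  have dRG := fun a b c d => (dR a b).fun_mul (dG c d)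
  have dGG := fun a b c d => (dG a b).fun_mul (dG c d)
  have d1 := (((dRG i k j l).fun_add (dRG j l i k)).fun_sub (dRG i l j k)).fun_sub (dRG j k i l)
  have h1 : pd m (weyl G i j k l) y = pd m (riem G i j k l) y
      - (1 / 2) * (pd m (ric G i k) y * G y j l + ric G i k y * pd m (fun z => G z j l) y
        + (pd m (ric G j l) y * G y i k + ric G j l y * pd m (fun z => G z i k) y)
        - (pd m (ric G i l) y * G y j k + ric G i l y * pd m (fun z => G z j k) y)
        - (pd m (ric G j k) y * G y i l + ric G j k y * pd m (fun z => G z i l) y))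
      + (6⁻¹ * pd m (scal G) y * (G y i k * G y j l - G y i l * G y j k)
        + 6⁻¹ * scal G y * (pd m (fun z => G z i k) y * G y j l
          + G y i k * pd m (fun z => G z j l) y
          - (pd m (fun z => G z i l) y * G y j k + G y i l * pd m (fun z => G z j k) y))) := by
    have e : weyl G i j k l = fun z => riem G i j k l z
        - (1 / 2) * (ric G i k z * G z j l + ric G j l z * G z i k
            - ric G i l z * G z j k - ric G j k z * G z i l)
        + 6⁻¹ * scal G z * (G z i k * G z j l - G z i l * G z j k) := by
      funext z; rw [weyl]; ring
    rw [e, pd_add (dRm.fun_sub (d1.const_mul _))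
        ((dS.const_mul _).fun_mul ((dGG i k j l).fun_sub (dGG i l j k))),
      pd_sub dRm (d1.const_mul _), pd_const_mul d1,
      pd_sub (((dRG i k j l).fun_add (dRG j l i k)).fun_sub (dRG i l j k)) (dRG j k i l),
      pd_sub ((dRG i k j l).fun_add (dRG j l i k)) (dRG i l j k),
      pd_add (dRG i k j l) (dRG j l i k),
      pd_mul (dS.const_mul _) ((dGG i k j l).fun_sub (dGG i l j k)), pd_const_mul dS,
      pd_sub (dGG i k j l) (dGG i l j k)]
    simp only [pd_mul (dR _ _) (dG _ _), pd_mul (dG _ _) (dG _ _)]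
  rw [covDeriv, h1]
  simp only [h.pd_metric hy, covDeriv, covDeriv2, weyl, Fin.sum_univ_four]
  ring

/-- The divergence of the Weyl tensor in dimension four is half the Cotton tensor. -/
theorem divergence_weyl (h : IsMetricOn G U) (hy : y ∈ U) (j k l : Fin 4) :
    divergence G (weyl G) j k l y
      = (1 / 2) * (covDeriv2 G (ric G) k j l y - covDeriv2 G (ric G) l j k y)
        - (1 / 12) * (pd k (scal G) y * G y j l - pd l (scal G) y * G y j k) := by
  have h1 := h.divergence_riem hy j k l
  have hk := h.divergence_ric hy k
  have hl := h.divergence_ric hy l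
  have e : divergence G (weyl G) j k l y = divergence G (riem G) j k l y
      - (1 / 2) * ((∑ i, ∑ m, ginv G i m y * covDeriv2 G (ric G) m i k y) * G y j l
        + ∑ i, ∑ m, ginv G i m y * (covDeriv2 G (ric G) m j l y * G y i k)
        - (∑ i, ∑ m, ginv G i m y * covDeriv2 G (ric G) m i l y) * G y j k
        - ∑ i, ∑ m, ginv G i m y * (covDeriv2 G (ric G) m j k y * G y i l))
      + (1 / 6) * ((∑ i, ∑ m, ginv G i m y * (pd m (scal G) y * G y i k)) * G y j l
        - (∑ i, ∑ m, ginv G i m y * (pd m (scal G) y * G y i l)) * G y j k) := by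
    simp only [divergence, h.covDeriv_weyl hy, Finset.sum_mul, Finset.mul_sum,
      ← Finset.sum_add_distrib, ← Finset.sum_sub_distrib]
    exact Finset.sum_congr rfl fun i _ => Finset.sum_congr rfl fun m _ => by ring
  rw [e, h1, hk, hl, h.sum_ginv_mul_metric hy (fun m => covDeriv2 G (ric G) m j l y),
    h.sum_ginv_mul_metric hy (fun m => covDeriv2 G (ric G) m j k y),
    h.sum_ginv_mul_metric hy (fun m => pd m (scal G) y),
    h.sum_ginv_mul_metric hy (fun m => pd m (scal G) y)]
  ring

/-- The Ricci identity for the differential of a function. -/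
theorem covDeriv2_hess_sub (h : IsMetricOn G U) (hy : y ∈ U) {u : E4 → ℝ}
    (hu : ContDiffOn ℝ ∞ u U) (k l j : Fin 4) :
    covDeriv2 G (hess G u) k l j y - covDeriv2 G (hess G u) l k j y
      = - ∑ e, riemUp G e k l j y * pd e u y := by
  have dΓ := fun a b c => h.differentiableAt hy (h.contDiffOn_christoffel a b c)
  have su := fun a => contDiffOn_pd h.isOpen hu a
  have du := fun a => h.differentiableAt hy (su a)
  have key : ∀ k l, pd k (hess G u l j) y = pd k (pd l (pd j u)) y
      - ∑ e, (pd k (christoffel G e l j) y * pd e u y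
        + christoffel G e l j y * pd k (pd e u) y) := by
    intro k l
    change pd k (fun z => pd l (pd j u) z - ∑ e, christoffel G e l j z * pd e u z) y = _
    rw [pd_sub (h.differentiableAt hy (contDiffOn_pd h.isOpen (su j) l))
      (DifferentiableAt.fun_sum fun e _ => (dΓ e l j).fun_mul (du e)),
      pd_sum_mul (fun e => dΓ e l j) du]
  simp only [covDeriv2, key]
  rw [pd_comm ((su j).contDiffAt (h.isOpen.mem_nhds hy)) k l]
  simp only [h.christoffel_symm _ l k, hess, riemUp, Fin.sum_univ_four]
  ring

section Soliton

variable {u : E4 → ℝ} {lam : ℝ}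

/-- On a gradient Ricci soliton `∇_k R_{jl} - ∇_l R_{jk} = R_{ijkl} ∇^i u`. -/
theorem covDeriv2_ric_sub_of_soliton (h : IsMetricOn G U) (hy : y ∈ U)
    (hu : ContDiffOn ℝ ∞ u U)
    (hsol : ∀ z ∈ U, ∀ i j, ric G i j z + hess G u i j z = lam * G z i j) (j k l : Fin 4) :
    covDeriv2 G (ric G) k j l y - covDeriv2 G (ric G) l j k y
      = ∑ i, riem G i j k l y * grad G u i y := by
  have h1 : ∀ m i j, covDeriv2 G (hess G u) m i j y = - covDeriv2 G (ric G) m i j y := by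
    intro m i j
    have e : ∀ z ∈ U, ∀ i j, hess G u i j z = lam * G z i j - ric G i j z := fun z hz i j => by
      linarith [hsol z hz i j]
    simp only [covDeriv2]
    rw [pd_congr h.isOpen (fun z hz => e z hz i j) hy,
      pd_sub ((h.differentiableAt hy (h.contDiffOn i j)).const_mul _)
        (h.differentiableAt hy (h.contDiffOn_ric i j)),
      pd_const_mul (h.differentiableAt hy (h.contDiffOn i j)), h.pd_metric hy]
    simp only [e y hy, Fin.sum_univ_four]
    ring
  have h2 := h.covDeriv2_hess_sub hy hu k l j
  rw [h1, h1] at h2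
  have h3 : ∑ i, riem G i j k l y * grad G u i y = ∑ e, riemUp G e k l j y * pd e u y := by
    have hp : ∀ i, riem G i j k l y = riem G k l i j y := fun i => h.riem_pair_symm hy i j k l
    simp only [hp]
    simp only [riem, ← h.sum_metric_mul_grad hy u, Finset.mul_sum,
      Finset.sum_mul]
    rw [Finset.sum_comm]
    refine Finset.sum_congr rfl fun e _ => Finset.sum_congr rfl fun i _ => ?_
    rw [h.symm y e i]; ring
  have hs := h.covDeriv2_symm hy (fun z hz i j => h.ric_symm hz i j)
  rw [h3, hs k j l, hs l j k]
  linarith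

/-- On a gradient Ricci soliton `Ric(∇u) = ½ ∇R`. -/
theorem ric_grad_of_soliton (h : IsMetricOn G U) (hy : y ∈ U)
    (hu : ContDiffOn ℝ ∞ u U)
    (hsol : ∀ z ∈ U, ∀ i j, ric G i j z + hess G u i j z = lam * G z i j) (k : Fin 4) :
    ∑ i, ric G i k y * grad G u i y = (1 / 2) * pd k (scal G) y := by
  have h1 : ∑ j, ∑ l, ginv G j l y * ∑ i, riem G i j k l y * grad G u i y
      = ∑ i, ric G i k y * grad G u i y := by
    simp only [ric, Fin.sum_univ_four]
    ring
  simp only [← h.covDeriv2_ric_sub_of_soliton hy hu hsol, mul_sub, Finset.sum_sub_distrib] at h1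
  rw [← h.pd_scal hy, h.divergence_ric hy] at h1
  linarith

/-- The formula for `D` on a gradient Ricci soliton. -/
theorem tensorD_of_soliton (h : IsMetricOn G U) (hy : y ∈ U)
    (hu : ContDiffOn ℝ ∞ u U)
    (hsol : ∀ z ∈ U, ∀ i j, ric G i j z + hess G u i j z = lam * G z i j) (j k l : Fin 4) :
    tensorD G u j k l y =
      (1 / 2) * (ric G j l y * pd k u y - ric G j k y * pd l u y)
      + (1 / 12) * (pd k (scal G) y * G y j l - pd l (scal G) y * G y j k)
      - scal G y / 6 * (G y j l * pd k u y - G y j k * pd l u y) := by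
  have hk := h.ric_grad_of_soliton hy hu hsol k
  have hl := h.ric_grad_of_soliton hy hu hsol l
  have gk := h.sum_metric_mul_grad hy u k
  have gl := h.sum_metric_mul_grad hy u l
  have e : ∑ i, weyl G i j k l y * grad G u i y
      = ∑ i, riem G i j k l y * grad G u i y
        - (1 / 2) * ((∑ i, ric G i k y * grad G u i y) * G y j l
          + ric G j l y * ∑ i, G y i k * grad G u i y
          - (∑ i, ric G i l y * grad G u i y) * G y j k
          - ric G j k y * ∑ i, G y i l * grad G u i y)
        + scal G y / 6 * ((∑ i, G y i k * grad G u i y) * G y j l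
          - (∑ i, G y i l * grad G u i y) * G y j k) := by
    simp only [weyl, Fin.sum_univ_four]
    ring
  rw [tensorD, e, hk, hl, gk, gl, h.divergence_weyl hy,
    h.covDeriv2_ric_sub_of_soliton hy hu hsol]
  ring

end Soliton

end IsMetricOn
end Coord
end

/-! ### The Levi-Civita symbol -/

noncomputable section
namespace Coord

/-- The Levi-Civita symbol as an integer: a Vandermonde product of the four indices, divided by
its value `12` at `(0, 1, 2, 3)`. -/
def epsInt (i j k l : Fin 4) : ℤ :=
  (((j : ℤ) - i) * ((k : ℤ) - i) * ((l : ℤ) - i) * ((k : ℤ) - j) * ((l : ℤ) - j) * ((l : ℤ) - k))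
    / 12

theorem twelve_mul_epsInt : ∀ i j k l : Fin 4, 12 * epsInt i j k l
    = ((j : ℤ) - i) * ((k : ℤ) - i) * ((l : ℤ) - i) * ((k : ℤ) - j) * ((l : ℤ) - j)
      * ((l : ℤ) - k) := by
  decide +kernel

theorem eps_eq_epsInt (i j k l : Fin 4) : eps i j k l = epsInt i j k l := by
  have h1 : (1 : Matrix (Fin 4) (Fin 4) ℝ).submatrix ![i, j, k, l] id
      * Matrix.vandermonde (fun a : Fin 4 => (a : ℝ))
      = Matrix.vandermonde (fun a : Fin 4 => ((![i, j, k, l] a : Fin 4) : ℝ)) := by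
    ext a b
    simp only [Matrix.mul_apply, Matrix.submatrix_apply, Matrix.one_apply, id, ite_mul, one_mul,
      zero_mul, Finset.sum_ite_eq, Finset.mem_univ, if_true, Matrix.vandermonde_apply]
  have h2 := congrArg Matrix.det h1
  rw [Matrix.det_mul, Matrix.det_vandermonde, Matrix.det_vandermonde] at h2
  have h3 : (12 : ℝ) * epsInt i j k l = ((j : ℝ) - i) * ((k : ℝ) - i) * ((l : ℝ) - i)
      * ((k : ℝ) - j) * ((l : ℝ) - j) * ((l : ℝ) - k) := by
    exact_mod_cast congrArg (Int.cast : ℤ → ℝ) (twelve_mul_epsInt i j k l)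
  have hI : (Finset.Ioi (0 : Fin 4)) = {1, 2, 3} ∧ (Finset.Ioi (1 : Fin 4)) = {2, 3}
      ∧ (Finset.Ioi (2 : Fin 4)) = {3} ∧ (Finset.Ioi (3 : Fin 4)) = ∅ := by decide
  change eps i j k l * _ = _ at h2
  simp [Fin.prod_univ_four, hI.1, hI.2.1, hI.2.2.1, hI.2.2.2] at h2
  norm_num at h2
  linarith

theorem eps_swap_left (i j k l : Fin 4) : eps i j k l = - eps j i k l := by
  have : ∀ i j k l, epsInt i j k l = - epsInt j i k l := by decide +kernel
  rw [eps_eq_epsInt, eps_eq_epsInt, this i j k l]; push_cast; ring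

theorem sum_eps_mul_eps (i j a b : Fin 4) :
    ∑ k, ∑ l, eps i j k l * eps k l a b
      = 2 * ((if i = a then 1 else 0) * (if j = b then 1 else 0)
        - (if i = b then 1 else 0) * (if j = a then 1 else 0)) := by
  have : ∀ i j a b, ∑ k, ∑ l, epsInt i j k l * epsInt k l a b
      = 2 * ((if i = a then 1 else 0) * (if j = b then 1 else 0)
        - (if i = b then 1 else 0) * (if j = a then 1 else 0)) := by decide +kernel
  simp only [eps_eq_epsInt]
  exact_mod_cast congrArg (Int.cast : ℤ → ℝ) (this i j a b)

/-- The Schouten identity: antisymmetrization over five indices vanishes in dimension four. -/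
theorem eps_schouten (i j k l a b : Fin 4) :
    (if a = b then 1 else 0) * eps i j k l
      = (if b = i then 1 else 0) * eps a j k l + (if b = j then 1 else 0) * eps i a k l
        + (if b = k then 1 else 0) * eps i j a l + (if b = l then 1 else 0) * eps i j k a := by
  have : ∀ i j k l a b : Fin 4, (if a = b then 1 else 0) * epsInt i j k l
      = (if b = i then 1 else 0) * epsInt a j k l + (if b = j then 1 else 0) * epsInt i a k l
        + (if b = k then 1 else 0) * epsInt i j a l
        + (if b = l then 1 else 0) * epsInt i j k a := by decide +kernel
  simp only [eps_eq_epsInt]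
  exact_mod_cast congrArg (Int.cast : ℤ → ℝ) (this i j k l a b)

theorem eps_of_eq_one {k l k' l' : Fin 4} (h : eps k l k' l' = 1) (e f : Fin 4) :
    eps k l e f = (if e = k' then 1 else 0) * (if f = l' then 1 else 0)
        - (if e = l' then 1 else 0) * (if f = k' then 1 else 0) := by
  have : ∀ k l k' l' : Fin 4, epsInt k l k' l' = 1 → ∀ e f, epsInt k l e f
      = (if e = k' then 1 else 0) * (if f = l' then 1 else 0)
        - (if e = l' then 1 else 0) * (if f = k' then 1 else 0) := by decide +kernel
  rw [eps_eq_epsInt] at h ⊢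
  exact_mod_cast congrArg (Int.cast : ℤ → ℝ) (this k l k' l' (by exact_mod_cast h) e f)

/-- The Levi-Civita symbol transforms under a matrix by its determinant. -/
theorem sum_mul_eps (v : Matrix (Fin 4) (Fin 4) ℝ) (a b c d : Fin 4) :
    ∑ i, ∑ j, ∑ k, ∑ l, v a i * v b j * v c k * v d l * eps i j k l = v.det * eps a b c d := by
  have h1 : v.submatrix ![a, b, c, d] id
      = (1 : Matrix (Fin 4) (Fin 4) ℝ).submatrix ![a, b, c, d] id * v := by
    ext p q
    simp only [Matrix.mul_apply, Matrix.submatrix_apply, Matrix.one_apply, id, ite_mul, one_mul,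
      zero_mul, Finset.sum_ite_eq, Finset.mem_univ, if_true]
  have h2 : (v.submatrix ![a, b, c, d] id).det = v.det * eps a b c d := by
    rw [h1, Matrix.det_mul, eps, mul_comm]
  rw [← h2]
  have h3 : v.submatrix ![a, b, c, d] id
      = fun p => ∑ i, v (![a, b, c, d] p) i • (Pi.single i 1 : Fin 4 → ℝ) := by
    funext p q
    simp [Finset.sum_apply, Pi.single_apply]
  let e : Fin 4 × Fin 4 × Fin 4 × Fin 4 ≃ (Fin 4 → Fin 4) :=
    { toFun := fun r => ![r.1, r.2.1, r.2.2.1, r.2.2.2]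
      invFun := fun r => (r 0, r 1, r 2, r 3)
      left_inv := fun _ => rfl
      right_inv := fun r => by funext p; fin_cases p <;> rfl }
  have h4 : (v.submatrix ![a, b, c, d] id).det = ∑ r : Fin 4 → Fin 4,
      (∏ p, v (![a, b, c, d] p) (r p)) * (Matrix.of fun p => Pi.single (r p) (1 : ℝ)).det := by
    rw [h3]
    change (Matrix.detRowAlternating (R := ℝ) (n := Fin 4)).toMultilinearMap
      (fun p => ∑ i, v (![a, b, c, d] p) i • (Pi.single i 1 : Fin 4 → ℝ)) = _
    rw [MultilinearMap.map_sum]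
    refine Finset.sum_congr rfl fun r _ => ?_
    rw [MultilinearMap.map_smul_univ]
    rfl
  rw [h4, ← Equiv.sum_comp e]
  simp only [Fintype.sum_prod_type]
  refine Finset.sum_congr rfl fun i _ => Finset.sum_congr rfl fun j _ =>
    Finset.sum_congr rfl fun k _ => Finset.sum_congr rfl fun l _ => ?_
  have h5 : (Matrix.of fun p => Pi.single (e (i, j, k, l) p) (1 : ℝ))
      = (1 : Matrix (Fin 4) (Fin 4) ℝ).submatrix ![i, j, k, l] id := by
    ext p q
    change (Pi.single (![i, j, k, l] p) (1 : ℝ) : Fin 4 → ℝ) q = _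
    simp only [Matrix.submatrix_apply, Matrix.one_apply, id, Pi.single_apply,
      eq_comm (a := q)]
  rw [h5, eps, Fin.prod_univ_four]
  rfl

end Coord
end

/-! ### The Hodge star on bivectors -/

noncomputable section
namespace Coord

theorem sum_sum_comm (F : Fin 4 → Fin 4 → Fin 4 → Fin 4 → ℝ) :
    ∑ a, ∑ b, ∑ c, ∑ d, F a b c d = ∑ c, ∑ d, ∑ a, ∑ b, F a b c d := by
  have : ∑ P : Fin 4 × Fin 4, ∑ Q : Fin 4 × Fin 4, F P.1 P.2 Q.1 Q.2
      = ∑ Q : Fin 4 × Fin 4, ∑ P : Fin 4 × Fin 4, F P.1 P.2 Q.1 Q.2 := Finset.sum_comm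
  simpa only [Fintype.sum_prod_type] using this

/-- The Hodge star on bivectors as a mixed tensor, `½ vol_{klpq} g^{pm} g^{qn}`. -/
def star (G : E4 → Matrix (Fin 4) (Fin 4) ℝ) (k l m n : Fin 4) (x : E4) : ℝ :=
  (1 / 2) * ∑ p, ∑ q, vol G k l p q x * ginv G p m x * ginv G q n x

theorem starRight_eq (G : E4 → Matrix (Fin 4) (Fin 4) ℝ)
    (T : Fin 4 → Fin 4 → Fin 4 → Fin 4 → E4 → ℝ) (i j k l : Fin 4) :
    starRight G T i j k l = fun x => ∑ m, ∑ n, star G k l m n x * T i j m n x := by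
  funext x
  simp only [starRight, star, Finset.mul_sum, Finset.sum_mul]
  rw [sum_sum_comm]
  simp only [mul_assoc]

theorem starLeft_eq (G : E4 → Matrix (Fin 4) (Fin 4) ℝ)
    (T : Fin 4 → Fin 4 → Fin 4 → Fin 4 → E4 → ℝ) (i j k l : Fin 4) :
    starLeft G T i j k l = fun x => ∑ m, ∑ n, star G i j m n x * T m n k l x := by
  funext x
  simp only [starLeft, star, Finset.mul_sum, Finset.sum_mul]
  rw [sum_sum_comm]
  simp only [mul_assoc]

/-- A tensor `U_{ij}^{pq}` which is skew in each pair and whose trace over `i = p` vanishes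
commutes with the Levi-Civita symbol. -/
theorem sum_eps_mul_comm {V : Fin 4 → Fin 4 → Fin 4 → Fin 4 → ℝ}
    (hl : ∀ i j p q, V i j p q = - V j i p q) (hr : ∀ i j p q, V i j p q = - V i j q p)
    (htr : ∀ j q, ∑ p, V p j p q = 0) (i j k l : Fin 4) :
    ∑ p, ∑ q, eps k l p q * V i j p q = ∑ p, ∑ q, eps i j p q * V k l p q := by
  let Φ : Fin 4 → Fin 4 → Fin 4 → Fin 4 → ℝ := fun k l i j => ∑ p, ∑ q, eps k l p q * V i j p q
  have a1 : ∀ k l i j, Φ k l i j = - Φ l k i j := fun k l i j => by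
    simp only [Φ, ← Finset.sum_neg_distrib, ← neg_mul, ← eps_swap_left k l]
  have a2 : ∀ k l i j, Φ k l i j = - Φ k l j i := fun k l i j => by
    simp only [Φ, ← Finset.sum_neg_distrib, ← mul_neg, ← hl i j]
  have hcyc : ∀ k l i j, Φ k l i j + Φ l i k j + Φ i k l j = 0 := by
    intro k l i j
    have t1 : ∑ p, ∑ q, ∑ a, ((if i = a then 1 else 0) * eps k l p q) * V a j p q = Φ k l i j := by
      simp only [Φ, ite_mul, one_mul, zero_mul, Finset.sum_ite_eq, Finset.mem_univ, if_true]
    have t2 : ∑ p, ∑ q, ∑ a, ((if i = a then 1 else 0) * eps k l p q) * V a j p q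
        = Φ i l k j + Φ k i l j + ∑ q, eps k l i q * ∑ p, V p j p q
          + ∑ p, eps k l p i * ∑ q, V q j p q := by
      have e : ∀ p q a, (if i = a then 1 else 0) * eps k l p q * V a j p q
          = (if a = k then eps i l p q * V a j p q else 0)
            + (if a = l then eps k i p q * V a j p q else 0)
            + (if a = p then eps k l i q * V a j p q else 0)
            + (if a = q then eps k l p i * V a j p q else 0) := by
        intro p q a
        rw [eps_schouten]
        simp only [add_mul, ite_mul, one_mul, zero_mul]
      simp only [e, Finset.sum_add_distrib, Finset.sum_ite_eq', Finset.mem_univ, if_true,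
        Finset.mul_sum]
      rw [Finset.sum_comm (f := fun p q => eps k l i q * V p j p q)]
    have htr' : ∀ p, ∑ q, V q j p q = 0 := fun p => by
      rw [← neg_eq_zero, ← htr j p, ← Finset.sum_neg_distrib]
      exact Finset.sum_congr rfl fun q _ => (hr _ _ _ _).symm
    rw [t1] at t2
    simp only [htr, htr', mul_zero, Finset.sum_const_zero, add_zero] at t2
    rw [t2, a1 i l, a1 k i]
    ring
  -- Skew symmetry in both pairs and the cyclic identity imply the symmetry under exchange of the
  -- pairs, as for the curvature tensor.
  change Φ k l i j = Φ i j k l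
  have c1 := hcyc k l i j
  have c2 := hcyc l i j k
  have c3 := hcyc i j k l
  have c4 := hcyc j k l i
  simp only [a2 _ _ j k, a2 _ _ i k, a2 _ _ j l, a2 _ _ i l, a2 _ _ j i, a2 _ _ l k,
    a1 j k, a1 i k, a1 j l] at c1 c2 c3 c4 ⊢
  linarith

namespace IsMetricOn

variable {G : E4 → Matrix (Fin 4) (Fin 4) ℝ} {U : Set E4} {y : E4}

theorem pd_sqrt_det (h : IsMetricOn G U) (hy : y ∈ U) (m : Fin 4) :
    pd m (fun z => Real.sqrt (G z).det) y
      = (∑ a, christoffel G a m a y) * Real.sqrt (G y).det := by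
  let C : Matrix (Fin 4) (Fin 4) ℝ := Matrix.of fun i j => christoffel G i m j y
  have ds := h.differentiableAt hy h.contDiffOn_sqrt_det
  have h1 : pd m (fun z => Real.sqrt (G z).det * Real.sqrt (G z).det) y
      = pd m (fun z => (G z).det) y :=
    pd_congr h.isOpen (fun z hz => Real.mul_self_sqrt (h.det_pos hz).le) hy m
  have h2 : (Matrix.of fun i j => pd m (fun z => G z i j) y) = C.transpose * G y + G y * C := by
    ext i j
    simp only [Matrix.of_apply, h.pd_metric hy, Matrix.add_apply, Matrix.mul_apply,
      Matrix.transpose_apply, C, Finset.sum_add_distrib, mul_comm (G y i _)]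
  have h3 : ((G y).adjugate * (C.transpose * G y + G y * C)).trace
      = 2 * C.trace * (G y).det := by
    rw [mul_add, Matrix.trace_add, ← mul_assoc (G y).adjugate (G y), Matrix.adjugate_mul,
      Matrix.trace_mul_comm, mul_assoc, Matrix.mul_adjugate]
    simp only [Matrix.mul_smul, Matrix.smul_mul, mul_one, one_mul, Matrix.trace_smul,
      Matrix.trace_transpose, smul_eq_mul]
    ring
  rw [pd_mul ds ds, pd_det (fun i j => h.differentiableAt hy (h.contDiffOn i j)), h2, h3,
    ← Real.mul_self_sqrt (h.det_pos hy).le] at h1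
  have hpos : 0 < Real.sqrt (G y).det := Real.sqrt_pos.2 (h.det_pos hy)
  have h4 : C.trace = ∑ a, christoffel G a m a y := rfl
  rw [← h4]
  have h5 : 2 * Real.sqrt (G y).det * (pd m (fun z => Real.sqrt (G z).det) y
      - C.trace * Real.sqrt (G y).det) = 0 := by
    rw [Real.mul_self_sqrt (h.det_pos hy).le] at h1
    have := Real.mul_self_sqrt (h.det_pos hy).le
    linear_combination h1 - 2 * C.trace * this
  rcases mul_eq_zero.1 h5 with h6 | h6
  · linarith
  · linarith

/-- The volume form is parallel. -/
theorem pd_vol (h : IsMetricOn G U) (hy : y ∈ U) (m i j k l : Fin 4) :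
    pd m (vol G i j k l) y = ∑ a, (christoffel G a m i y * vol G a j k l y
      + christoffel G a m j y * vol G i a k l y + christoffel G a m k y * vol G i j a l y
      + christoffel G a m l y * vol G i j k a y) := by
  have h1 : (∑ a, christoffel G a m a y) * eps i j k l
      = ∑ a, (christoffel G a m i y * eps a j k l + christoffel G a m j y * eps i a k l
        + christoffel G a m k y * eps i j a l + christoffel G a m l y * eps i j k a) := by
    have t1 : ∑ a, ∑ b, christoffel G a m b y * ((if a = b then 1 else 0) * eps i j k l)
        = (∑ a, christoffel G a m a y) * eps i j k l := by
      simp only [ite_mul, one_mul, zero_mul, mul_ite, mul_zero, Finset.sum_ite_eq,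
        Finset.mem_univ, if_true, Finset.sum_mul]
    rw [← t1]
    refine Finset.sum_congr rfl fun a _ => ?_
    have e : ∀ b, christoffel G a m b y * ((if a = b then 1 else 0) * eps i j k l) = _ :=
      fun b => by rw [eps_schouten]
    simp only [e]
    simp only [mul_add, ite_mul, one_mul, zero_mul, mul_ite, mul_zero,
      Finset.sum_add_distrib, Finset.sum_ite_eq', Finset.mem_univ, if_true]
  change pd m (fun z => Real.sqrt (G z).det * eps i j k l) y = _
  rw [pd_mul (h.differentiableAt hy h.contDiffOn_sqrt_det) (differentiableAt_const _), pd_const,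
    h.pd_sqrt_det hy, mul_zero, add_zero, mul_right_comm, h1, Finset.sum_mul]
  exact Finset.sum_congr rfl fun a _ => by simp only [vol]; ring

theorem contDiffOn_vol (h : IsMetricOn G U) (i j k l : Fin 4) :
    ContDiffOn ℝ ∞ (vol G i j k l) U :=
  h.contDiffOn_sqrt_det.mul contDiffOn_const

theorem contDiffOn_star (h : IsMetricOn G U) (k l m n : Fin 4) :
    ContDiffOn ℝ ∞ (star G k l m n) U :=
  contDiffOn_const.mul (ContDiffOn.sum fun _ _ => ContDiffOn.sum fun _ _ =>
    ((h.contDiffOn_vol _ _ _ _).mul (h.contDiffOn_ginv _ _)).mul (h.contDiffOn_ginv _ _))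

/-- The Hodge star is parallel. -/
theorem pd_star (h : IsMetricOn G U) (hy : y ∈ U) (r k l m n : Fin 4) :
    pd r (star G k l m n) y = ∑ a, (christoffel G a r k y * star G a l m n y
      + christoffel G a r l y * star G k a m n y - christoffel G m r a y * star G k l a n y
      - christoffel G n r a y * star G k l m a y) := by
  have dV := fun i j k l => h.differentiableAt hy (h.contDiffOn_vol i j k l)
  have dH := fun i j => h.differentiableAt hy (h.contDiffOn_ginv i j)
  have d1 := fun p q => ((dV k l p q).fun_mul (dH p m)).fun_mul (dH q n)
  have h1 : pd r (star G k l m n) y = (1 / 2) * ∑ p, ∑ q,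
      ((pd r (vol G k l p q) y * ginv G p m y + vol G k l p q y * pd r (ginv G p m) y)
          * ginv G q n y + vol G k l p q y * ginv G p m y * pd r (ginv G q n) y) := by
    change pd r (fun z => (1 / 2) * ∑ p, ∑ q, vol G k l p q z * ginv G p m z * ginv G q n z) y = _
    rw [pd_const_mul (DifferentiableAt.fun_sum fun p _ => DifferentiableAt.fun_sum fun q _ =>
      d1 p q), pd_sum (a := fun p z => ∑ q, vol G k l p q z * ginv G p m z * ginv G q n z)
        fun p _ => DifferentiableAt.fun_sum fun q _ => d1 p q]
    congr 1
    refine Finset.sum_congr rfl fun p _ => ?_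
    rw [pd_sum (a := fun q z => vol G k l p q z * ginv G p m z * ginv G q n z)
      fun q _ => d1 p q]
    refine Finset.sum_congr rfl fun q _ => ?_
    rw [pd_mul ((dV k l p q).fun_mul (dH p m)) (dH q n), pd_mul (dV k l p q) (dH p m)]
  rw [h1]
  simp only [h.pd_vol hy, h.pd_ginv hy, star, Fin.sum_univ_four]
  ring

theorem covDeriv_starRight (h : IsMetricOn G U) (hy : y ∈ U)
    {T : Fin 4 → Fin 4 → Fin 4 → Fin 4 → E4 → ℝ}
    (hT : ∀ i j k l, DifferentiableAt ℝ (T i j k l) y) (r i j k l : Fin 4) :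
    covDeriv G (starRight G T) r i j k l y
      = ∑ m, ∑ n, star G k l m n y * covDeriv G T r i j m n y := by
  have dS := fun m n => h.differentiableAt hy (h.contDiffOn_star k l m n)
  have h1 : pd r (starRight G T i j k l) y = ∑ m, ∑ n,
      (pd r (star G k l m n) y * T i j m n y + star G k l m n y * pd r (T i j m n) y) := by
    rw [starRight_eq, pd_sum (a := fun m z => ∑ n, star G k l m n z * T i j m n z)
      fun m _ => DifferentiableAt.fun_sum fun n _ => (dS m n).fun_mul (hT i j m n)]
    exact Finset.sum_congr rfl fun m _ => pd_sum_mul (fun n => dS m n) (fun n => hT i j m n) r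
  rw [covDeriv, h1]
  simp only [h.pd_star hy, covDeriv, starRight_eq, Fin.sum_univ_four]
  ring

/-- The square of the Hodge star is the antisymmetrizer, that is, the identity of bivectors. -/
theorem star_mul_star (h : IsMetricOn G U) (hy : y ∈ U) (i j a b : Fin 4) :
    ∑ m, ∑ n, star G i j m n y * star G m n a b y
      = (1 / 2) * ((if i = a then 1 else 0) * (if j = b then 1 else 0)
        - (if i = b then 1 else 0) * (if j = a then 1 else 0)) := by
  have hdet : Real.sqrt (G y).det * Real.sqrt (G y).det * ((G y)⁻¹).det = 1 := by
    rw [Real.mul_self_sqrt (h.det_pos hy).le, Matrix.det_nonsing_inv, Ring.inverse_eq_inv',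
      mul_inv_cancel₀ (h.det_pos hy).ne']
  obtain ⟨K, hK⟩ : ∃ K : Fin 4 → Fin 4 → ℝ,
      K = fun m n => ∑ r, ∑ t, ginv G a r y * ginv G b t y * eps m n r t := ⟨_, rfl⟩
  have e1 : ∀ m n, star G m n a b y = (1 / 2) * Real.sqrt (G y).det * K m n := by
    intro m n
    simp only [star, vol, hK, Finset.mul_sum, h.ginv_symm a, h.ginv_symm b]
    exact Finset.sum_congr rfl fun r _ => Finset.sum_congr rfl fun t _ => by ring
  have e2 : ∀ m n, star G i j m n y * star G m n a b y
      = ∑ p, ∑ q, ((1 / 4) * (Real.sqrt (G y).det * Real.sqrt (G y).det) * eps i j p q)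
          * (ginv G p m y * ginv G q n y * K m n) := by
    intro m n
    rw [e1]
    simp only [star, vol, Finset.mul_sum, Finset.sum_mul]
    exact Finset.sum_congr rfl fun r _ => Finset.sum_congr rfl fun t _ => by ring
  have e3 : ∀ p q, ∑ m, ∑ n, ginv G p m y * ginv G q n y * K m n
      = ((G y)⁻¹).det * eps p q a b := by
    intro p q
    rw [← sum_mul_eps]
    simp only [hK, Finset.mul_sum, ginv, mul_assoc]
  simp only [e2]
  rw [sum_sum_comm]
  simp only [← Finset.mul_sum, e3]
  have e4 : ∀ p q, (1 / 4) * (Real.sqrt (G y).det * Real.sqrt (G y).det) * eps i j p q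
      * (((G y)⁻¹).det * eps p q a b) = (1 / 4) * (eps i j p q * eps p q a b) := by
    intro p q
    linear_combination (1 / 4) * eps i j p q * eps p q a b * hdet
  simp only [e4, ← Finset.mul_sum, sum_eps_mul_eps]
  ring

end IsMetricOn

end Coord
end

/-! ### Self-dual parts of the Weyl tensor -/

noncomputable section
namespace Coord
namespace IsMetricOn

variable {G : E4 → Matrix (Fin 4) (Fin 4) ℝ} {U : Set E4} {y : E4}

theorem weyl_antisymm_left (i j k l : Fin 4) (y : E4) :
    weyl G i j k l y = - weyl G j i k l y := by
  simp only [weyl, riem_antisymm_left i j]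
  ring

theorem weyl_pair_symm (h : IsMetricOn G U) (hy : y ∈ U) (i j k l : Fin 4) :
    weyl G i j k l y = weyl G k l i j y := by
  rw [weyl, weyl, h.riem_pair_symm hy, h.ric_symm hy k i, h.ric_symm hy l j, h.ric_symm hy k j,
    h.ric_symm hy l i, h.symm y k i, h.symm y l j, h.symm y k j, h.symm y l i]
  ring

theorem weyl_antisymm_right (h : IsMetricOn G U) (hy : y ∈ U) (i j k l : Fin 4) :
    weyl G i j k l y = - weyl G i j l k y := by
  rw [h.weyl_pair_symm hy, weyl_antisymm_left, h.weyl_pair_symm hy]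

/-- The Weyl tensor is trace free. -/
theorem sum_ginv_mul_weyl (h : IsMetricOn G U) (hy : y ∈ U) (j l : Fin 4) :
    ∑ i, ∑ m, ginv G i m y * weyl G i j m l y = 0 := by
  have t1 : ∑ i, ∑ m, ginv G i m y * riem G i j m l y = ric G j l y := by
    simp only [ric]
    refine Finset.sum_congr rfl fun i _ => Finset.sum_congr rfl fun m _ => ?_
    rw [riem_antisymm_left, h.riem_antisymm_right hy]
  have t2 : ∑ i, ∑ m, ginv G i m y * (ric G i l y * G y j m) = ric G j l y := by
    rw [← h.sum_ginv_mul_metric hy (fun m => ric G m l y) j, Finset.sum_comm]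
    refine Finset.sum_congr rfl fun i _ => Finset.sum_congr rfl fun m _ => ?_
    rw [h.ginv_symm m i, h.symm y j i]
  have t3 := h.sum_ginv_mul_metric hy (fun m => ric G j m y) l
  have t4 := h.sum_ginv_mul_metric hy (fun m => G y j m) l
  have t5 : ∑ i, ∑ m, ginv G i m y * G y i m = 4 := by
    have : ∀ i, ∑ m, ginv G i m y * G y i m = 1 := fun i => by
      simpa [h.symm y i] using h.sum_ginv_mul hy i i
    simp [this]
  have e : ∑ i, ∑ m, ginv G i m y * weyl G i j m l y
      = ∑ i, ∑ m, ginv G i m y * riem G i j m l y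
        - (1 / 2) * ((∑ i, ∑ m, ginv G i m y * ric G i m y) * G y j l
          + ric G j l y * ∑ i, ∑ m, ginv G i m y * G y i m
          - ∑ i, ∑ m, ginv G i m y * (ric G i l y * G y j m)
          - ∑ i, ∑ m, ginv G i m y * (ric G j m y * G y i l))
        + scal G y / 6 * ((∑ i, ∑ m, ginv G i m y * G y i m) * G y j l
          - ∑ i, ∑ m, ginv G i m y * (G y j m * G y i l)) := by
    simp only [weyl, Fin.sum_univ_four]
    ring
  rw [e, t1, t2, t3, t4, t5]
  change ric G j l y - 1 / 2 * (scal G y * G y j l + _ - _ - _) + _ = 0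
  ring

/-- The Hodge star commutes with the Weyl curvature operator. -/
theorem starLeft_weyl (h : IsMetricOn G U) (hy : y ∈ U) (i j k l : Fin 4) :
    starLeft G (weyl G) i j k l y = starRight G (weyl G) i j k l y := by
  -- the Weyl tensor with its last pair of indices raised
  let V : Fin 4 → Fin 4 → Fin 4 → Fin 4 → ℝ := fun i j p q =>
    ∑ m, ∑ n, ginv G p m y * ginv G q n y * weyl G i j m n y
  have hR : ∀ i j k l, starRight G (weyl G) i j k l y
      = (1 / 2) * Real.sqrt (G y).det * ∑ p, ∑ q, eps k l p q * V i j p q := by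
    intro i j k l
    simp only [starRight, vol, V, Finset.mul_sum]
    exact Finset.sum_congr rfl fun _ _ => Finset.sum_congr rfl fun _ _ =>
      Finset.sum_congr rfl fun _ _ => Finset.sum_congr rfl fun _ _ => by ring
  have hL : starLeft G (weyl G) i j k l y = starRight G (weyl G) k l i j y := by
    simp only [starLeft, starRight]
    congr 1
    exact Finset.sum_congr rfl fun _ _ => Finset.sum_congr rfl fun _ _ =>
      Finset.sum_congr rfl fun _ _ => Finset.sum_congr rfl fun _ _ => by
        rw [h.weyl_pair_symm hy]
  rw [hL, hR, hR]
  congr 1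
  refine sum_eps_mul_comm ?_ ?_ ?_ k l i j
  · intro i j p q
    simp only [V, ← Finset.sum_neg_distrib, ← mul_neg, ← weyl_antisymm_left i j]
  · intro i j p q
    simp only [V]
    rw [Finset.sum_comm, ← Finset.sum_neg_distrib]
    refine Finset.sum_congr rfl fun n _ => ?_
    rw [← Finset.sum_neg_distrib]
    refine Finset.sum_congr rfl fun m _ => ?_
    rw [h.weyl_antisymm_right hy i j m n]
    ring
  · intro j q
    have e : ∑ p, V p j p q
        = ∑ n, ginv G q n y * ∑ p, ∑ m, ginv G p m y * weyl G p j m n y := by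
      simp only [V, Finset.mul_sum]
      rw [Finset.sum_comm_cycle]
      exact Finset.sum_congr rfl fun _ _ => Finset.sum_congr rfl fun _ _ =>
        Finset.sum_congr rfl fun _ _ => by ring
    rw [e]
    simp only [h.sum_ginv_mul_weyl hy, mul_zero, Finset.sum_const_zero]

/-- The Weyl operator commutes with the star, and the star is an involution on bivectors. -/
theorem starLeft_starRight_weyl (h : IsMetricOn G U) (hy : y ∈ U) (i j k l : Fin 4) :
    starLeft G (starRight G (weyl G)) i j k l y = weyl G i j k l y := by
  rw [starLeft_eq]
  simp only [← h.starLeft_weyl hy]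
  simp only [starLeft_eq, Finset.mul_sum]
  rw [sum_sum_comm]
  simp only [← mul_assoc, ← Finset.sum_mul, h.star_mul_star hy]
  have : ∀ a b, (1 / 2 : ℝ) * ((if i = a then 1 else 0) * (if j = b then 1 else 0)
        - (if i = b then 1 else 0) * (if j = a then 1 else 0)) * weyl G a b k l y
      = (if i = a then (if j = b then (1 / 2) * weyl G a b k l y else 0) else 0)
        - (if j = a then (if i = b then (1 / 2) * weyl G a b k l y else 0) else 0) := by
    intro a b
    split_ifs <;> ring
  simp only [this, Finset.sum_sub_distrib, Finset.sum_ite_irrel, Finset.sum_const_zero,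
    Finset.sum_ite_eq, Finset.mem_univ, if_true]
  rw [weyl_antisymm_left j i]
  ring

theorem dualPart_weyl (h : IsMetricOn G U) (hy : y ∈ U) (s : ℝ) (i j k l : Fin 4) :
    dualPart s G (weyl G) i j k l y
      = (1 / 2) * weyl G i j k l y + s / 2 * starRight G (weyl G) i j k l y := by
  rw [dualPart, h.starLeft_weyl hy, h.starLeft_starRight_weyl hy]
  ring

/-- `D^±` is half the sum of `D` and `±` its Hodge dual in the last two indices. -/
theorem tensorDpm_eq (h : IsMetricOn G U) (hy : y ∈ U) (s : ℝ) (u : E4 → ℝ) (j k l : Fin 4) :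
    tensorDpm s G u j k l y
      = (1 / 2) * (tensorD G u j k l y
        + s * ∑ m, ∑ n, star G k l m n y * tensorD G u j m n y) := by
  have dW := fun i j k l => h.differentiableAt hy (h.contDiffOn_weyl i j k l)
  have dSW : ∀ i j k l, DifferentiableAt ℝ (starRight G (weyl G) i j k l) y := by
    intro i j k l
    rw [starRight_eq]
    exact DifferentiableAt.fun_sum fun m _ => DifferentiableAt.fun_sum fun n _ =>
      (h.differentiableAt hy (h.contDiffOn_star k l m n)).fun_mul (dW i j m n)
  have hcov : ∀ r i j k l, covDeriv G (dualPart s G (weyl G)) r i j k l y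
      = (1 / 2) * covDeriv G (weyl G) r i j k l y
        + s / 2 * covDeriv G (starRight G (weyl G)) r i j k l y := by
    intro r i j k l
    simp only [covDeriv]
    rw [pd_congr h.isOpen (fun z hz => h.dualPart_weyl hz s i j k l) hy,
      pd_add ((dW i j k l).const_mul _) ((dSW i j k l).const_mul _), pd_const_mul (dW i j k l),
      pd_const_mul (dSW i j k l)]
    simp only [h.dualPart_weyl hy, Fin.sum_univ_four]
    ring
  have hdiv : divergence G (dualPart s G (weyl G)) j k l y
      = (1 / 2) * divergence G (weyl G) j k l y
        + s / 2 * ∑ m, ∑ n, star G k l m n y * divergence G (weyl G) j m n y := by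
    simp only [divergence, hcov, h.covDeriv_starRight hy dW, mul_add, Finset.sum_add_distrib,
      Finset.mul_sum]
    rw [sum_sum_comm]
    congr 1
    · exact Finset.sum_congr rfl fun _ _ => Finset.sum_congr rfl fun _ _ => by ring
    · exact Finset.sum_congr rfl fun _ _ => Finset.sum_congr rfl fun _ _ =>
        Finset.sum_congr rfl fun _ _ => Finset.sum_congr rfl fun _ _ => by ring
  have hcon : ∑ i, dualPart s G (weyl G) i j k l y * grad G u i y
      = (1 / 2) * ∑ i, weyl G i j k l y * grad G u i y
        + s / 2 * ∑ m, ∑ n, star G k l m n y * ∑ i, weyl G i j m n y * grad G u i y := by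
    simp only [h.dualPart_weyl hy, starRight_eq, Fin.sum_univ_four]
    ring
  rw [tensorDpm, hdiv, hcon]
  simp only [tensorD, Finset.mul_sum, mul_sub, mul_add, Finset.sum_sub_distrib]
  simp only [← Finset.mul_sum, mul_left_comm _ (2 : ℝ)]
  ring

end IsMetricOn
end Coord
end

/-! ### Orthonormal bases -/

noncomputable section
namespace Coord

open scoped MatrixOrder in
/-- A Gram matrix of a scalar product admits a positively oriented orthonormal basis. -/
theorem exists_isPosOrthonormal {G : E4 → Matrix (Fin 4) (Fin 4) ℝ} {x : E4}
    (hG : (G x).PosDef) : ∃ v, IsPosOrthonormal G x v := by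
  obtain ⟨B, hB⟩ := CStarAlgebra.nonneg_iff_eq_star_mul_self.1 hG.posSemidef.nonneg
  rw [Matrix.star_eq_conjTranspose, Matrix.conjTranspose_eq_transpose_of_trivial] at hB
  have hBd : B.det ≠ 0 := by
    intro h0
    have := hG.det_pos
    rw [hB, Matrix.det_mul, h0, mul_zero] at this
    exact lt_irrefl _ this
  have hinv : B * B⁻¹ = 1 := Matrix.mul_nonsing_inv _ hBd.isUnit
  have key : ∀ w : Matrix (Fin 4) (Fin 4) ℝ, w * G x * w.transpose = 1 →
      ∀ a b, ∑ i, ∑ j, G x i j * w a i * w b j = if a = b then 1 else 0 := by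
    intro w hw a b
    have := congrFun (congrFun hw a) b
    simp only [Matrix.mul_apply, Matrix.transpose_apply, Matrix.one_apply, Finset.sum_mul] at this
    rw [← this, Finset.sum_comm]
    exact Finset.sum_congr rfl fun j _ => Finset.sum_congr rfl fun i _ => by ring
  have hw0 : B⁻¹.transpose * G x * B⁻¹.transpose.transpose = 1 := by
    rw [hB, Matrix.transpose_transpose, ← mul_assoc, ← Matrix.transpose_mul, hinv,
      Matrix.transpose_one, one_mul, hinv]
  have hd0 : B⁻¹.transpose.det ≠ 0 := by
    intro h0
    have := congrArg Matrix.det hw0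
    rw [Matrix.det_mul, Matrix.det_mul, h0, zero_mul, zero_mul, Matrix.det_one] at this
    exact zero_ne_one this
  rcases hd0.lt_or_gt with hneg | hpos
  · -- reverse the first basis vector
    let S : Matrix (Fin 4) (Fin 4) ℝ := Matrix.diagonal ![-1, 1, 1, 1]
    have hS : S * S.transpose = 1 := by
      rw [Matrix.diagonal_transpose, Matrix.diagonal_mul_diagonal, ← Matrix.diagonal_one]
      congr 1
      funext i
      fin_cases i <;> simp
    refine ⟨S * B⁻¹.transpose, key _ ?_, ?_⟩
    · rw [Matrix.transpose_mul]
      calc S * B⁻¹.transpose * G x * (B⁻¹.transpose.transpose * S.transpose)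
          = S * (B⁻¹.transpose * G x * B⁻¹.transpose.transpose) * S.transpose := by
            simp only [mul_assoc]
        _ = 1 := by rw [hw0, mul_one, hS]
    · rw [Matrix.det_mul, Matrix.det_diagonal, Fin.prod_univ_four]
      simpa using hneg
  · exact ⟨_, key _ hw0, hpos⟩

namespace IsPosOrthonormal

variable {G : E4 → Matrix (Fin 4) (Fin 4) ℝ} {x : E4} {v : Matrix (Fin 4) (Fin 4) ℝ}

theorem mul_mul_transpose (hv : IsPosOrthonormal G x v) : v * G x * v.transpose = 1 := by
  ext a b
  rw [Matrix.one_apply, ← hv.1 a b]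
  simp only [Matrix.mul_apply, Matrix.transpose_apply, Finset.sum_mul]
  rw [Finset.sum_comm]
  exact Finset.sum_congr rfl fun j _ => Finset.sum_congr rfl fun i _ => by ring

theorem ginv_eq (hv : IsPosOrthonormal G x v) (i j : Fin 4) :
    ginv G i j x = ∑ a, v a i * v a j := by
  have h1 : G x * v.transpose * v = 1 := by
    apply mul_eq_one_comm.1
    rw [← mul_assoc, hv.mul_mul_transpose]
  rw [mul_assoc] at h1
  rw [ginv, Matrix.inv_eq_right_inv h1]
  simp [Matrix.mul_apply]

theorem sqrt_det_mul_det (hv : IsPosOrthonormal G x v) (hG : (G x).PosDef) :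
    Real.sqrt (G x).det * v.det = 1 := by
  have h1 := congrArg Matrix.det hv.mul_mul_transpose
  rw [Matrix.det_mul, Matrix.det_mul, Matrix.det_transpose, Matrix.det_one] at h1
  have h2 := Real.mul_self_sqrt hG.det_pos.le
  have h3 : 0 ≤ Real.sqrt (G x).det * v.det := mul_nonneg (Real.sqrt_nonneg _) hv.2.le
  have h4 : (Real.sqrt (G x).det * v.det) * (Real.sqrt (G x).det * v.det) = 1 := by
    linear_combination h1 + v.det * v.det * h2
  nlinarith

/-- The Hodge star with its lower indices contracted with vectors of a positive orthonormal basis: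
the determinant of the basis cancels the density `√det G` of the volume form. -/
theorem sum_mul_star (hv : IsPosOrthonormal G x v) (hG : (G x).PosDef) (c d m n : Fin 4) :
    ∑ j, ∑ k, v c j * v d k * star G j k m n x
      = (1 / 2) * ∑ e, ∑ f, eps c d e f * (v e m * v f n) := by
  have hd := hv.sqrt_det_mul_det hG
  have h1 : ∀ e f, eps c d e f * (v e m * v f n) = ∑ j, ∑ k, ∑ p, ∑ q,
      Real.sqrt (G x).det * (v c j * v d k * v e p * v f q * eps j k p q) * (v e m * v f n) := by
    intro e f
    simp only [← Finset.sum_mul, ← Finset.mul_sum, sum_mul_eps]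
    linear_combination (-(eps c d e f * (v e m * v f n))) * hd
  have h2 : ∀ j k, v c j * v d k * star G j k m n x = (1 / 2) * ∑ p, ∑ q, ∑ e, ∑ f,
      Real.sqrt (G x).det * (v c j * v d k * v e p * v f q * eps j k p q) * (v e m * v f n) := by
    intro j k
    rw [star, mul_left_comm, Finset.mul_sum]
    congr 1
    refine Finset.sum_congr rfl fun p _ => ?_
    rw [Finset.mul_sum]
    refine Finset.sum_congr rfl fun q _ => ?_
    rw [mul_assoc (vol G j k p q x), hv.ginv_eq, hv.ginv_eq, Finset.sum_mul_sum, Finset.mul_sum,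
      Finset.mul_sum]
    refine Finset.sum_congr rfl fun e _ => ?_
    rw [Finset.mul_sum, Finset.mul_sum]
    exact Finset.sum_congr rfl fun f _ => by rw [vol]; ring
  have h3 := Finset.sum_comm (s := (Finset.univ : Finset (Fin 4 × Fin 4 × Fin 4 × Fin 4)))
    (t := (Finset.univ : Finset (Fin 4 × Fin 4))) (f := fun Q P =>
      Real.sqrt (G x).det * (v c Q.1 * v d Q.2.1 * v P.1 Q.2.2.1 * v P.2 Q.2.2.2
        * eps Q.1 Q.2.1 Q.2.2.1 Q.2.2.2) * (v P.1 m * v P.2 n))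
  simp only [Fintype.sum_prod_type] at h3
  simp only [h2]
  simp_rw [← Finset.mul_sum (a := (1 / 2 : ℝ))]
  rw [h3]
  simp only [h1]

/-- In a positive orthonormal basis the components of the Hodge star are given by the
Levi-Civita symbol. -/
theorem inBasis3_star (hv : IsPosOrthonormal G x v) (hG : (G x).PosDef)
    (B : Fin 4 → Fin 4 → Fin 4 → E4 → ℝ) (b c d : Fin 4) :
    inBasis3 v (fun j k l y => ∑ m, ∑ n, star G k l m n y * B j m n y) x b c d
      = (1 / 2) * ∑ e, ∑ f, eps c d e f * inBasis3 v B x b e f := by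
  have h1 : ∀ i, ∑ j, ∑ k, v b i * v c j * v d k * ∑ m, ∑ n, star G j k m n x * B i m n x
      = ∑ m, ∑ n, ((1 / 2) * ∑ e, ∑ f, eps c d e f * (v e m * v f n)) * (v b i * B i m n x) := by
    intro i
    simp only [← hv.sum_mul_star hG, Finset.mul_sum, Finset.sum_mul]
    rw [sum_sum_comm]
    exact Finset.sum_congr rfl fun _ _ => Finset.sum_congr rfl fun _ _ =>
      Finset.sum_congr rfl fun _ _ => Finset.sum_congr rfl fun _ _ => by ring
  simp only [inBasis3]
  simp only [h1]
  simp only [Finset.mul_sum, Finset.sum_mul]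
  have := Finset.sum_comm (s := (Finset.univ : Finset (Fin 4 × Fin 4 × Fin 4)))
    (t := (Finset.univ : Finset (Fin 4 × Fin 4))) (f := fun Q P =>
      1 / 2 * (eps c d P.1 P.2 * (v P.1 Q.2.1 * v P.2 Q.2.2)) * (v b Q.1 * B Q.1 Q.2.1 Q.2.2 x))
  simp only [Fintype.sum_prod_type] at this
  rw [this]
  exact Finset.sum_congr rfl fun _ _ => Finset.sum_congr rfl fun _ _ =>
    Finset.sum_congr rfl fun _ _ => Finset.sum_congr rfl fun _ _ =>
      Finset.sum_congr rfl fun _ _ => by ring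

theorem normSq3_eq (hv : IsPosOrthonormal G x v) (B : Fin 4 → Fin 4 → Fin 4 → E4 → ℝ) :
    normSq3 G B x = ∑ a, ∑ b, ∑ c, inBasis3 v B x a b c ^ 2 := by
  have h1 : ∀ i j k a b c, ginv G i a x * ginv G j b x * ginv G k c x * B i j k x * B a b c x
      = ∑ p, ∑ q, ∑ r, (v p i * v q j * v r k * B i j k x) * (v p a * v q b * v r c * B a b c x) := by
    intro i j k a b c
    rw [hv.ginv_eq, hv.ginv_eq, hv.ginv_eq, Finset.sum_mul_sum, Finset.sum_mul, Finset.sum_mul,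
      Finset.sum_mul]
    refine Finset.sum_congr rfl fun p _ => ?_
    rw [Finset.sum_mul, Finset.sum_mul, Finset.sum_mul]
    refine Finset.sum_congr rfl fun q _ => ?_
    rw [Finset.mul_sum, Finset.sum_mul, Finset.sum_mul]
    exact Finset.sum_congr rfl fun r _ => by ring
  simp only [normSq3, h1]
  have := Finset.sum_comm
    (s := (Finset.univ : Finset ((Fin 4 × Fin 4 × Fin 4) × Fin 4 × Fin 4 × Fin 4)))
    (t := (Finset.univ : Finset (Fin 4 × Fin 4 × Fin 4))) (f := fun Q P =>
      (v P.1 Q.1.1 * v P.2.1 Q.1.2.1 * v P.2.2 Q.1.2.2 * B Q.1.1 Q.1.2.1 Q.1.2.2 x)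
        * (v P.1 Q.2.1 * v P.2.1 Q.2.2.1 * v P.2.2 Q.2.2.2 * B Q.2.1 Q.2.2.1 Q.2.2.2 x))
  simp only [Fintype.sum_prod_type] at this
  rw [this]
  refine Finset.sum_congr rfl fun _ _ => Finset.sum_congr rfl fun _ _ =>
    Finset.sum_congr rfl fun _ _ => ?_
  simp only [← Finset.mul_sum, ← Finset.sum_mul, inBasis3, sq]

theorem normSq2_eq (hv : IsPosOrthonormal G x v) (A : Fin 4 → Fin 4 → E4 → ℝ) :
    normSq2 G A x = ∑ a, ∑ b, inBasis2 v A x a b ^ 2 := by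
  have h1 : ∀ i j a b, ginv G i a x * ginv G j b x * A i j x * A a b x
      = ∑ p, ∑ q, (v p i * v q j * A i j x) * (v p a * v q b * A a b x) := by
    intro i j a b
    rw [hv.ginv_eq, hv.ginv_eq, Finset.sum_mul_sum]
    simp only [Finset.sum_mul]
    exact Finset.sum_congr rfl fun _ _ => Finset.sum_congr rfl fun _ _ => by ring
  simp only [normSq2, h1]
  have := Finset.sum_comm (s := (Finset.univ : Finset ((Fin 4 × Fin 4) × Fin 4 × Fin 4)))
    (t := (Finset.univ : Finset (Fin 4 × Fin 4))) (f := fun Q P =>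
      (v P.1 Q.1.1 * v P.2 Q.1.2 * A Q.1.1 Q.1.2 x) * (v P.1 Q.2.1 * v P.2 Q.2.2 * A Q.2.1 Q.2.2 x))
  simp only [Fintype.sum_prod_type] at this
  rw [this]
  refine Finset.sum_congr rfl fun _ _ => Finset.sum_congr rfl fun _ _ => ?_
  simp only [← Finset.mul_sum, ← Finset.sum_mul, inBasis2, sq]

theorem normSq1_eq (hv : IsPosOrthonormal G x v) (θ : Fin 4 → E4 → ℝ) :
    normSq1 G θ x = ∑ a, inBasis1 v θ x a ^ 2 := by
  simp only [normSq1, hv.ginv_eq, inBasis1, Fin.sum_univ_four]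
  ring

end IsPosOrthonormal
end Coord
end

/-! ### Metrics and functions in charts -/

section Charts
variable {M : Type*} [TopologicalSpace M] [ChartedSpace E4 M] [IsManifold (𝓡 4) ∞ M]

theorem contMDiffOn_coordVec {φ : OpenPartialHomeomorph M E4}
    (hφ : φ ∈ IsManifold.maximalAtlas (𝓡 4) ∞ M) (i : Fin 4) :
    ContMDiffOn 𝓘(ℝ, E4) ((𝓡 4).prod 𝓘(ℝ, E4)) ∞
      (fun y => (⟨φ.symm y, coordVec φ i y⟩ : TangentBundle (𝓡 4) M)) φ.target := by
  have h1 : ContMDiffOn 𝓘(ℝ, E4) (𝓡 4) ∞ φ.symm φ.target :=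
    contMDiffOn_symm_of_mem_maximalAtlas hφ
  have h2 := h1.contMDiffOn_tangentMapWithin (m := ∞) (by simp) φ.open_target.uniqueMDiffOn
  have h3 : ContMDiff 𝓘(ℝ, E4) (𝓘(ℝ, E4).prod 𝓘(ℝ, E4)) ∞
      (fun y : E4 => (⟨y, EuclideanSpace.single i (1:ℝ)⟩ : TangentBundle 𝓘(ℝ, E4) E4)) := by
    intro y
    rw [Bundle.contMDiffAt_totalSpace]
    refine ⟨contMDiffAt_id, ?_⟩
    simpa using contMDiffAt_const
  refine (h2.comp h3.contMDiffOn (fun y hy => hy)).congr ?_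
  intro y hy
  simp only [Function.comp, tangentMapWithin, coordVec]
  rw [mfderivWithin_of_isOpen φ.open_target hy]

theorem contDiffOn_metricIn (g : SmoothMetric M) {φ : OpenPartialHomeomorph M E4}
    (hφ : φ ∈ IsManifold.maximalAtlas (𝓡 4) ∞ M) (i j : Fin 4) :
    ContDiffOn ℝ ∞ (fun y => metricIn g φ y i j) φ.target := by
  rw [← contMDiffOn_iff_contDiffOn]
  intro y hy
  have h1 : ContMDiffOn 𝓘(ℝ, E4) (𝓡 4) ∞ φ.symm φ.target :=
    contMDiffOn_symm_of_mem_maximalAtlas hφ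
  have hg := (g.contMDiff.contMDiffAt (x := φ.symm y)).comp_contMDiffWithinAt y (h1 y hy)
  have := ContMDiffWithinAt.clm_bundle_apply₂ (F₁ := E4) (F₂ := E4) (F₃ := ℝ)
    (E₁ := fun p : M => TangentSpace (𝓡 4) p) (E₂ := fun p : M => TangentSpace (𝓡 4) p)
    (E₃ := Bundle.Trivial M ℝ) (b := φ.symm)
    (ψ := fun y => g.inner (φ.symm y)) (v := coordVec φ i) (w := coordVec φ j)
    hg (contMDiffOn_coordVec hφ i y hy) (contMDiffOn_coordVec hφ j y hy)
  rw [Bundle.contMDiffWithinAt_totalSpace] at this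
  exact this.2

theorem metricIn_posDef (g : SmoothMetric M) {φ : OpenPartialHomeomorph M E4}
    (hφ : φ ∈ IsManifold.maximalAtlas (𝓡 4) ∞ M) {y : E4} (hy : y ∈ φ.target) :
    (metricIn g φ y).PosDef := by
  have hsd : MDifferentiableAt 𝓘(ℝ, E4) (𝓡 4) φ.symm y :=
    ((contMDiffOn_symm_of_mem_maximalAtlas hφ).contMDiffAt
      (φ.open_target.mem_nhds hy)).mdifferentiableAt (by simp)
  have hd : MDifferentiableAt (𝓡 4) 𝓘(ℝ, E4) φ (φ.symm y) :=
    ((contMDiffOn_of_mem_maximalAtlas hφ).contMDiffAt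
      (φ.open_source.mem_nhds (φ.map_target hy))).mdifferentiableAt (by simp)
  set L := mfderiv 𝓘(ℝ, E4) (𝓡 4) φ.symm y with hL
  -- `mfderiv φ` is a left inverse of `mfderiv φ.symm`.
  have hinj : ∀ w : E4, L w = 0 → w = 0 := by
    intro w hw
    have hc := mfderiv_comp y hd hsd
    have he : (φ ∘ φ.symm) =ᶠ[nhds y] id := by
      filter_upwards [φ.open_target.mem_nhds hy] with z hz using φ.right_inv hz
    rw [he.mfderiv_eq, mfderiv_id] at hc
    have := congrArg (fun T => T w) hc
    simp only [Function.comp] at this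
    have h2 : (mfderiv (𝓡 4) 𝓘(ℝ, E4) φ (φ.symm y)) (L w) = 0 := by
      rw [hw]; exact map_zero _
    exact this.trans h2
  have hsum : ∀ c : Fin 4 → ℝ, L (WithLp.toLp 2 c : E4) = ∑ i, c i • coordVec φ i y := by
    intro c
    have : (WithLp.toLp 2 c : E4) = ∑ i, c i • EuclideanSpace.single i (1:ℝ) := by
      ext k; simp [Pi.single_apply, Finset.sum_apply]
    rw [this]
    erw [map_sum]
    refine Finset.sum_congr rfl fun i _ => ?_
    erw [map_smul]
    rfl
  refine Matrix.PosDef.of_dotProduct_mulVec_pos ?_ ?_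
  · ext i j
    simp [metricIn, Matrix.conjTranspose_apply, g.symm]
  · intro c hc
    have hne : L (WithLp.toLp 2 c : E4) ≠ 0 := by
      intro h0
      apply hc
      have := hinj _ h0
      simpa using congrArg (WithLp.ofLp) this
    have hp := g.pos (φ.symm y) _ hne
    rw [hsum c] at hp
    simp only [map_sum, map_smul, _root_.sum_apply, _root_.smul_apply,
      smul_eq_mul] at hp
    simp only [dotProduct, Matrix.mulVec, metricIn, Matrix.of_apply, star_trivial]
    refine hp.trans_eq ?_
    refine Finset.sum_congr rfl fun i _ => ?_
    rw [Finset.mul_sum, Finset.mul_sum]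
    refine Finset.sum_congr rfl fun j _ => ?_
    rw [g.symm]
    ring

end Charts

theorem contDiffOn_funIn {M : Type*} [TopologicalSpace M] [ChartedSpace E4 M] {f : M → ℝ}
    (hf : ContMDiff (𝓡 4) 𝓘(ℝ, ℝ) ∞ f) {φ : OpenPartialHomeomorph M E4}
    (hφ : φ ∈ IsManifold.maximalAtlas (𝓡 4) ∞ M) :
    ContDiffOn ℝ ∞ (funIn f φ) φ.target := by
  rw [← contMDiffOn_iff_contDiffOn]
  exact hf.comp_contMDiffOn (contMDiffOn_symm_of_mem_maximalAtlas hφ)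

/-! ### Components and norms of `D` and `D^±` -/

noncomputable section
namespace Coord

/-- The square norm of `N = ½ (M + s * M)` for skew `M`, where `* M` is the dual of `M`: the mixed
term is a multiple of the Pfaffian of `M`. -/
theorem sum_sq_half_add_dual {M N : Fin 4 → Fin 4 → ℝ} {s : ℝ} (hs : s = 1 ∨ s = -1)
    (hM : ∀ k l, M k l = - M l k) (hN0 : ∀ k, N k k = 0)
    (hN : ∀ k l k' l', eps k l k' l' = 1 → N k l = (1 / 2) * (M k l + s * M k' l')) :
    ∑ k, ∑ l, N k l ^ 2 = (1 / 2) * ∑ k, ∑ l, M k l ^ 2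
      + 2 * s * (M 0 1 * M 2 3 + M 0 2 * M 3 1 + M 0 3 * M 1 2) := by
  have he : ∀ k l k' l', epsInt k l k' l' = 1 → N k l = (1 / 2) * (M k l + s * M k' l') :=
    fun k l k' l' h => hN k l k' l' (by rw [eps_eq_epsInt, h]; simp)
  have hM0 : ∀ k, M k k = 0 := fun k => by linarith [hM k k]
  have hs2 : s ^ 2 = 1 := by rcases hs with rfl | rfl <;> norm_num
  simp only [Fin.sum_univ_four, hN0, hM0]
  rw [he 0 1 2 3 (by decide), he 0 2 3 1 (by decide), he 0 3 1 2 (by decide),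
    he 1 0 3 2 (by decide), he 1 2 0 3 (by decide), he 1 3 2 0 (by decide),
    he 2 0 1 3 (by decide), he 2 1 3 0 (by decide), he 2 3 0 1 (by decide),
    he 3 0 2 1 (by decide), he 3 1 0 2 (by decide), he 3 2 1 0 (by decide),
    hM 1 0, hM 2 0, hM 3 0, hM 2 1, hM 1 3, hM 3 2]
  linear_combination (1 / 2) * (M 0 1 ^ 2 + M 0 2 ^ 2 + M 0 3 ^ 2 + M 1 2 ^ 2 + M 3 1 ^ 2
    + M 2 3 ^ 2) * hs2

/-- The components in an orthonormal basis of the right-hand side of the formula for `D`, for a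
symmetric tensor `A`, a number `S` and covectors `f` and `r`. -/
def solitonForm (A : Fin 4 → Fin 4 → ℝ) (S : ℝ) (f r : Fin 4 → ℝ) (j k l : Fin 4) : ℝ :=
  (1 / 2) * (A j l * f k - A j k * f l)
    + (1 / 12) * (r k * (if j = l then 1 else 0) - r l * (if j = k then 1 else 0))
    - S / 6 * ((if j = l then 1 else 0) * f k - (if j = k then 1 else 0) * f l)

theorem solitonForm_antisymm (A : Fin 4 → Fin 4 → ℝ) (S : ℝ) (f r : Fin 4 → ℝ) (j k l : Fin 4) :
    solitonForm A S f r j k l = - solitonForm A S f r j l k := by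
  simp only [solitonForm]; ring

/-- The tensor on the right-hand side of the formula for `D` is orthogonal to its Hodge dual. -/
theorem sum_solitonForm_mul_dual {A : Fin 4 → Fin 4 → ℝ} (hA : ∀ i j, A i j = A j i) (S : ℝ)
    (f r : Fin 4 → ℝ) :
    ∑ j, (solitonForm A S f r j 0 1 * solitonForm A S f r j 2 3
      + solitonForm A S f r j 0 2 * solitonForm A S f r j 3 1
      + solitonForm A S f r j 0 3 * solitonForm A S f r j 1 2) = 0 := by
  simp only [solitonForm, Fin.sum_univ_four, hA 1 0, hA 2 0, hA 3 0, hA 2 1, hA 3 1, hA 3 2,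
    Fin.isValue, Fin.reduceEq, if_true, if_false]
  ring

/-- The square norm of the tensor on the right-hand side of the formula for `D`, when `S` is the
trace of `A` and `A f = ½ r`. -/
theorem sum_sq_solitonForm {A : Fin 4 → Fin 4 → ℝ} {S : ℝ} {f r : Fin 4 → ℝ}
    (hA : ∀ i j, A i j = A j i) (hS : ∑ i, A i i = S)
    (hr : ∀ j, ∑ i, A i j * f i = (1 / 2) * r j) :
    (1 / 2) * ∑ j, ∑ k, ∑ l, solitonForm A S f r j k l ^ 2
      = (1 / 4) * (∑ i, ∑ j, (A i j - S / 4 * if i = j then 1 else 0) ^ 2) * ∑ i, f i ^ 2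
        - (1 / 48) * ∑ i, (S * f i - 2 * r i) ^ 2 := by
  -- `D` is a combination of `A ∧ f` and `g ∧ c` with `c = r / 12 - S f / 6`: the
  -- summands are the square of the first, the mixed term and the square of the second.
  have h1 : ∑ j, ∑ k, ∑ l, solitonForm A S f r j k l ^ 2
      = (1 / 2) * ((∑ i, ∑ j, A i j ^ 2) * ∑ i, f i ^ 2 - ∑ j, (∑ i, A i j * f i) ^ 2)
        + 2 * ((∑ i, A i i) * ∑ i, f i * (r i / 12 - S * f i / 6)
          - ∑ j, (∑ i, A i j * f i) * (r j / 12 - S * f j / 6))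
        + 6 * ∑ i, (r i / 12 - S * f i / 6) ^ 2 := by
    simp only [solitonForm, Fin.sum_univ_four, hA 1 0, hA 2 0, hA 3 0, hA 2 1, hA 3 1, hA 3 2,
      Fin.isValue, Fin.reduceEq, if_true, if_false]
    ring
  have h2 : ∑ i, ∑ j, (A i j - S / 4 * if i = j then 1 else 0) ^ 2
      = ∑ i, ∑ j, A i j ^ 2 - S / 2 * ∑ i, A i i + S ^ 2 / 4 := by
    simp only [Fin.sum_univ_four, Fin.isValue, Fin.reduceEq, if_true, if_false]
    ring
  rw [h1, h2, hS]
  simp only [hr]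
  generalize ∑ i, ∑ j, A i j ^ 2 = N
  simp only [Fin.sum_univ_four]
  ring

namespace IsPosOrthonormal

variable {G : E4 → Matrix (Fin 4) (Fin 4) ℝ} {U : Set E4} {x : E4}
  {v : Matrix (Fin 4) (Fin 4) ℝ} {u : E4 → ℝ} {lam : ℝ}

theorem inBasis3_tensorD (hv : IsPosOrthonormal G x v) (h : IsMetricOn G U) (hx : x ∈ U)
    (hu : ContDiffOn ℝ ∞ u U)
    (hsol : ∀ z ∈ U, ∀ i j, ric G i j z + hess G u i j z = lam * G z i j) (j k l : Fin 4) :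
    inBasis3 v (tensorD G u) x j k l = solitonForm (inBasis2 v (ric G) x) (scal G x)
      (inBasis1 v (fun i => pd i u) x) (inBasis1 v (fun i => pd i (scal G)) x) j k l := by
  have h1 : ∀ (A : Fin 4 → Fin 4 → E4 → ℝ) (θ : Fin 4 → E4 → ℝ) b c d,
      ∑ i, ∑ j, ∑ k, v b i * v c j * v d k * (A i k x * θ j x)
        = inBasis2 v A x b d * inBasis1 v θ x c := by
    intro A θ b c d
    simp only [inBasis2, inBasis1, Fin.sum_univ_four]
    ring
  have h2 : ∀ (A : Fin 4 → Fin 4 → E4 → ℝ) (θ : Fin 4 → E4 → ℝ) b c d,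
      ∑ i, ∑ j, ∑ k, v b i * v c j * v d k * (A i j x * θ k x)
        = inBasis2 v A x b c * inBasis1 v θ x d := by
    intro A θ b c d
    simp only [inBasis2, inBasis1, Fin.sum_univ_four]
    ring
  have hG : ∀ a b, inBasis2 v (fun i j y => G y i j) x a b = if a = b then 1 else 0 := by
    intro a b
    rw [← hv.1 a b]
    exact Finset.sum_congr rfl fun i _ => Finset.sum_congr rfl fun j _ => by ring
  have r1 := h1 (ric G) (fun i => pd i u) j k l
  have r2 := h2 (ric G) (fun i => pd i u) j k l
  have r3 := h1 (fun i j y => G y i j) (fun i => pd i u) j k l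
  have r4 := h2 (fun i j y => G y i j) (fun i => pd i u) j k l
  have r5 := h1 (fun i j y => G y i j) (fun i => pd i (scal G)) j k l
  have r6 := h2 (fun i j y => G y i j) (fun i => pd i (scal G)) j k l
  rw [hG] at r3 r4 r5 r6
  have e : ∀ a b c, v j a * v k b * v l c * tensorD G u a b c x
      = (1 / 2) * (v j a * v k b * v l c * (ric G a c x * pd b u x))
        - (1 / 2) * (v j a * v k b * v l c * (ric G a b x * pd c u x))
        + (1 / 12) * (v j a * v k b * v l c * (G x a c * pd b (scal G) x))
        - (1 / 12) * (v j a * v k b * v l c * (G x a b * pd c (scal G) x))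
        - scal G x / 6 * (v j a * v k b * v l c * (G x a c * pd b u x))
        + scal G x / 6 * (v j a * v k b * v l c * (G x a b * pd c u x)) := by
    intro a b c
    rw [h.tensorD_of_soliton hx hu hsol]
    ring
  rw [inBasis3]
  simp only [e, Finset.sum_add_distrib, Finset.sum_sub_distrib, ← Finset.mul_sum]
  rw [r1, r2, r3, r4, r5, r6, solitonForm]
  ring

/-- In a positive orthonormal basis the dual part `D^±` is half of `D` plus or minus its dual,
formed with the Levi-Civita symbol. -/
theorem inBasis3_tensorDpm (hv : IsPosOrthonormal G x v) (h : IsMetricOn G U) (hx : x ∈ U)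
    (s : ℝ) (j k l : Fin 4) :
    inBasis3 v (tensorDpm s G u) x j k l = (1 / 2) * (inBasis3 v (tensorD G u) x j k l
      + s * ((1 / 2) * ∑ e, ∑ f, eps k l e f * inBasis3 v (tensorD G u) x j e f)) := by
  rw [← hv.inBasis3_star (h.posDef x hx)]
  simp only [inBasis3, h.tensorDpm_eq hx]
  rw [mul_add, mul_left_comm, ← mul_assoc s]
  simp only [Finset.mul_sum (a := s * (1 / 2)), Finset.mul_sum (a := (1 / 2 : ℝ)),
    ← Finset.sum_add_distrib]
  exact Finset.sum_congr rfl fun a _ => Finset.sum_congr rfl fun b _ =>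
    Finset.sum_congr rfl fun c _ => by ring

/-- For skew components the Hodge star is the replacement of a pair by its complement. -/
theorem inBasis3_tensorDpm_of_eps (hv : IsPosOrthonormal G x v) (h : IsMetricOn G U)
    (hx : x ∈ U)
    (hD : ∀ j k l, inBasis3 v (tensorD G u) x j k l = - inBasis3 v (tensorD G u) x j l k)
    (s : ℝ) {j k l k' l' : Fin 4} (he : eps k l k' l' = 1) :
    inBasis3 v (tensorDpm s G u) x j k l = (1 / 2) * (inBasis3 v (tensorD G u) x j k l
      + s * inBasis3 v (tensorD G u) x j k' l') := by
  rw [hv.inBasis3_tensorDpm h hx]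
  simp only [eps_of_eq_one he, sub_mul, ite_mul, one_mul, zero_mul, mul_ite, mul_one, mul_zero,
    Finset.sum_sub_distrib, Finset.sum_ite_eq', Finset.mem_univ, if_true]
  rw [hD j l' k']
  ring

theorem inBasis3_tensorDpm_self (hv : IsPosOrthonormal G x v) (h : IsMetricOn G U) (hx : x ∈ U)
    (hD : ∀ j k l, inBasis3 v (tensorD G u) x j k l = - inBasis3 v (tensorD G u) x j l k)
    (s : ℝ) (j k : Fin 4) : inBasis3 v (tensorDpm s G u) x j k k = 0 := by
  have he : ∀ e f, eps k k e f = 0 := fun e f => by linarith [eps_swap_left k k e f]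
  have h0 : inBasis3 v (tensorD G u) x j k k = 0 := by linarith [hD j k k]
  rw [hv.inBasis3_tensorDpm h hx, h0]
  simp only [he, zero_mul, Finset.sum_const_zero, mul_zero, add_zero]

theorem inBasis2_ric_symm (v : Matrix (Fin 4) (Fin 4) ℝ) (h : IsMetricOn G U) (hx : x ∈ U)
    (a b : Fin 4) : inBasis2 v (ric G) x a b = inBasis2 v (ric G) x b a := by
  simp only [inBasis2]
  rw [Finset.sum_comm]
  exact Finset.sum_congr rfl fun j _ => Finset.sum_congr rfl fun i _ => by
    rw [h.ric_symm hx]; ring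

theorem sum_inBasis2_ric_diag (hv : IsPosOrthonormal G x v) :
    ∑ a, inBasis2 v (ric G) x a a = scal G x := by
  simp only [inBasis2, scal, hv.ginv_eq, Fin.sum_univ_four]
  ring

theorem sum_inBasis2_ric_mul (hv : IsPosOrthonormal G x v) (h : IsMetricOn G U) (hx : x ∈ U)
    (hu : ContDiffOn ℝ ∞ u U)
    (hsol : ∀ z ∈ U, ∀ i j, ric G i j z + hess G u i j z = lam * G z i j) (b : Fin 4) :
    ∑ a, inBasis2 v (ric G) x a b * inBasis1 v (fun i => pd i u) x a
      = (1 / 2) * inBasis1 v (fun i => pd i (scal G)) x b := by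
  have e : ∑ a, inBasis2 v (ric G) x a b * inBasis1 v (fun i => pd i u) x a
      = ∑ j, v b j * ∑ i, ric G i j x * grad G u i x := by
    simp only [inBasis2, inBasis1, grad, hv.ginv_eq, Fin.sum_univ_four]
    ring
  rw [e, inBasis1, Finset.mul_sum]
  exact Finset.sum_congr rfl fun j _ => by rw [h.ric_grad_of_soliton hx hu hsol]; ring

/-- Both `|D^+|²` and `|D^-|²` are half of `|D|²`. -/
theorem normSq3_tensorDpm (hv : IsPosOrthonormal G x v) (h : IsMetricOn G U) (hx : x ∈ U)
    (hu : ContDiffOn ℝ ∞ u U)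
    (hsol : ∀ z ∈ U, ∀ i j, ric G i j z + hess G u i j z = lam * G z i j)
    {s : ℝ} (hs : s = 1 ∨ s = -1) :
    normSq3 G (tensorDpm s G u) x = (1 / 2) * normSq3 G (tensorD G u) x := by
  have hD := hv.inBasis3_tensorD h hx hu hsol
  have hDs : ∀ j k l, inBasis3 v (tensorD G u) x j k l = - inBasis3 v (tensorD G u) x j l k :=
    fun j k l => by rw [hD, hD, solitonForm_antisymm]
  rw [hv.normSq3_eq, hv.normSq3_eq, Finset.mul_sum]
  have h1 : ∀ j, ∑ k, ∑ l, inBasis3 v (tensorDpm s G u) x j k l ^ 2 = _ := fun j =>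
    sum_sq_half_add_dual hs (hDs j) (hv.inBasis3_tensorDpm_self h hx hDs s j)
      (fun _ _ _ _ he => hv.inBasis3_tensorDpm_of_eps h hx hDs s he)
  simp only [h1, Finset.sum_add_distrib, ← Finset.mul_sum, add_eq_left]
  simp only [hD, ← Finset.sum_add_distrib, sum_solitonForm_mul_dual (inBasis2_ric_symm v h hx), mul_zero]

/-- The norm of `D` in terms of the traceless Ricci tensor, `∇u` and `∇R`. -/
theorem normSq3_tensorD (hv : IsPosOrthonormal G x v) (h : IsMetricOn G U) (hx : x ∈ U)
    (hu : ContDiffOn ℝ ∞ u U)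
    (hsol : ∀ z ∈ U, ∀ i j, ric G i j z + hess G u i j z = lam * G z i j) :
    (1 / 2) * normSq3 G (tensorD G u) x
      = (1 / 4) * normSq2 G (ric0 G) x * normSq1 G (fun i => pd i u) x
        - (1 / 48) * normSq1 G (fun i y => scal G y * pd i u y - 2 * pd i (scal G) y) x := by
  have h0 : ∀ a b, inBasis2 v (ric0 G) x a b
      = inBasis2 v (ric G) x a b - scal G x / 4 * if a = b then 1 else 0 := by
    intro a b
    rw [← hv.1 a b]
    simp only [inBasis2, ric0, Finset.mul_sum, ← Finset.sum_sub_distrib]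
    exact Finset.sum_congr rfl fun j _ => Finset.sum_congr rfl fun i _ => by ring
  have h1 : ∀ a, inBasis1 v (fun i y => scal G y * pd i u y - 2 * pd i (scal G) y) x a
      = scal G x * inBasis1 v (fun i => pd i u) x a
        - 2 * inBasis1 v (fun i => pd i (scal G)) x a := by
    intro a
    simp only [inBasis1, Finset.mul_sum, ← Finset.sum_sub_distrib]
    exact Finset.sum_congr rfl fun i _ => by ring
  simp only [hv.normSq3_eq, hv.normSq2_eq, hv.normSq1_eq, h0, h1,
    hv.inBasis3_tensorD h hx hu hsol]
  exact sum_sq_solitonForm (inBasis2_ric_symm v h hx) hv.sum_inBasis2_ric_diag (hv.sum_inBasis2_ric_mul h hx hu hsol)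

end IsPosOrthonormal
end Coord

theorem isMetricOn_metricIn {M : Type*} [TopologicalSpace M] [ChartedSpace E4 M]
    [IsManifold (𝓡 4) ∞ M] (g : SmoothMetric M) {φ : OpenPartialHomeomorph M E4}
    (hφ : φ ∈ IsManifold.maximalAtlas (𝓡 4) ∞ M) :
    Coord.IsMetricOn (metricIn g φ) φ.target where
  isOpen := φ.open_target
  contDiffOn := contDiffOn_metricIn g hφ
  symm _ _ _ := g.symm _ _ _
  posDef _ hy := metricIn_posDef g hφ hy

end
/-- Indices `j k l` below are with respect to arbitrary local coordinates `φ` in the formula for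
`D` and with respect to an arbitrary positive orthonormal basis `e_a = v_a^i ∂_i` in the formula
for `D^±`. The domain of `φ` carries the orientation of the coordinates; charts of both
orientations are allowed, so on an oriented manifold one takes the positive ones. -/
theorem lemma2p3 {M : Type*} [TopologicalSpace M] [ChartedSpace E4 M]
    [IsManifold (𝓡 4) ∞ M] (g : SmoothMetric M) (f : M → ℝ)
    (hsol : IsGradientRicciSoliton g f)
    (φ : OpenPartialHomeomorph M E4) (hφ : φ ∈ IsManifold.maximalAtlas (𝓡 4) ∞ M)
    (x : E4) (hx : x ∈ φ.target) :
    let G : E4 → Matrix (Fin 4) (Fin 4) ℝ := metricIn g φ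
    let u : E4 → ℝ := funIn f φ
    -- the formula for `D`
    (∀ j k l : Fin 4,
      Coord.tensorD G u j k l x =
        (1 / 2) * (Coord.ric G j l x * Coord.pd k u x - Coord.ric G j k x * Coord.pd l u x)
        + (1 / 12) * (Coord.pd k (Coord.scal G) x * G x j l
            - Coord.pd l (Coord.scal G) x * G x j k)
        - Coord.scal G x / 6 * (G x j l * Coord.pd k u x - G x j k * Coord.pd l u x)) ∧
    -- the formula for `D^±`
    (∀ v : Matrix (Fin 4) (Fin 4) ℝ, Coord.IsPosOrthonormal G x v →
      let Rc : Fin 4 → Fin 4 → ℝ := Coord.inBasis2 v (Coord.ric G) x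
      let df : Fin 4 → ℝ := Coord.inBasis1 v (fun i => Coord.pd i u) x
      let dR : Fin 4 → ℝ := Coord.inBasis1 v (fun i => Coord.pd i (Coord.scal G)) x
      let δ : Fin 4 → Fin 4 → ℝ := fun a b => if a = b then 1 else 0
      ∀ s : ℝ, s = 1 ∨ s = -1 →
        let Ds : Fin 4 → Fin 4 → Fin 4 → ℝ := Coord.inBasis3 v (Coord.tensorDpm s G u) x
        (∀ j k l k' l' : Fin 4, Coord.eps k l k' l' = 1 →
          Ds j k l =
            (1 / 4) * (Rc j l * df k - Rc j k * df l)
            + (1 / 24) * (dR k * δ j l - dR l * δ j k)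
            - Coord.scal G x / 12 * (δ j l * df k - δ j k * df l)
            + s * ((1 / 4) * (Rc j l' * df k' - Rc j k' * df l'))
            + s * ((1 / 24) * (dR k' * δ j l' - dR l' * δ j k'))
            - s * (Coord.scal G x / 12 * (δ j l' * df k' - δ j k' * df l'))) ∧
        (∀ j k : Fin 4, Ds j k k = 0)) ∧
    -- the norms
    Coord.normSq3 G (Coord.tensorDpm 1 G u) x = Coord.normSq3 G (Coord.tensorDpm (-1) G u) x ∧
    Coord.normSq3 G (Coord.tensorDpm (-1) G u) x
      = (1 / 2) * Coord.normSq3 G (Coord.tensorD G u) x ∧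
    (1 / 2) * Coord.normSq3 G (Coord.tensorD G u) x =
      (1 / 4) * Coord.normSq2 G (Coord.ric0 G) x * Coord.normSq1 G (fun i => Coord.pd i u) x
      - (1 / 48) * Coord.normSq1 G
          (fun i y => Coord.scal G y * Coord.pd i u y - 2 * Coord.pd i (Coord.scal G) y) x := by

  intro G u
  obtain ⟨hf, lam, hlam⟩ := hsol
  have h : Coord.IsMetricOn G φ.target := isMetricOn_metricIn g hφ
  have hu : ContDiffOn ℝ ∞ u φ.target := contDiffOn_funIn hf hφ
  have hs : ∀ z ∈ φ.target, ∀ i j, Coord.ric G i j z + Coord.hess G u i j z = lam * G z i j :=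
    hlam φ hφ
  obtain ⟨w, hw⟩ := Coord.exists_isPosOrthonormal (h.posDef x hx)
  refine ⟨h.tensorD_of_soliton hx hu hs, ?_, ?_, ?_, ?_⟩
  · intro v hv Rc df dR δ s _ Ds
    have hD := hv.inBasis3_tensorD h hx hu hs
    have hDs : ∀ j k l, Coord.inBasis3 v (Coord.tensorD G u) x j k l
        = - Coord.inBasis3 v (Coord.tensorD G u) x j l k :=
      fun j k l => by rw [hD, hD, Coord.solitonForm_antisymm]
    refine ⟨fun j k l k' l' he => ?_, hv.inBasis3_tensorDpm_self h hx hDs s⟩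
    refine (hv.inBasis3_tensorDpm_of_eps h hx hDs s he).trans ?_
    rw [hD, hD, Coord.solitonForm, Coord.solitonForm]
    ring
  · rw [hw.normSq3_tensorDpm h hx hu hs (Or.inl rfl), hw.normSq3_tensorDpm h hx hu hs (Or.inr rfl)]
  · exact hw.normSq3_tensorDpm h hx hu hs (Or.inr rfl)
  · exact hw.normSq3_tensorD h hx hu hs
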